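/- **Theorem 3.1.** An instance of Max Rainbow Matching is a finite simple undirected graph $G=(V,E)$ together with an arbitrary (not necessarily proper) edge coloring $\phi$ of $G$. A rainbow matching in $(G,\phi)$ is a set $M\subseteq E$ of pairwise disjoint edges with pairwise distinct colors, and $\mathrm{opt}(G,\phi)$ denotes the largest number of edges of a rainbow matching in $(G,\phi)$. For every real $\varepsilon>0$ there is an algorithm that, given any edge-colored graph $(G,\phi)$, outputs in time polynomial in the size of the input a rainbow matching $M$ in $(G,\phi)$ with $$|M|\ \ge\ \Bigl(\tfrac23-\varepsilon\Bigr)\cdot \mathrm{opt}(G,\phi).$$ The algorithm and the polynomial may depend on $\varepsilon$. The input is the number of vertices and the list of the edges with their two endvertices and their color, where vertices and colors are represented by natural numbers written in binary. -/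

import Mathlib

/-! ### Random access machines

A machine has registers `0, 1, 2, …` and memory arrays `0, 1, 2, …`, all of whose cells hold
natural numbers; a program is a finite term, so it uses only finitely many registers and arrays.
The arithmetic operations are addition and truncated subtraction. There is no multiplication, so
in `t` steps the bit length of the largest number stored grows by at most `O(t)`, and polynomial
time is the same as on Turing machines. -/

namespace RAM

/-- The contents of the registers and of the memory arrays. -/
structure State where
  reg : ℕ → ℕ
  arr : ℕ → ℕ → ℕ

/-- Expressions. `get a i` is the cell of array `a` at the address to which `i` evaluates. -/
inductive Exp where
  | const (k : ℕ)
  | reg (x : ℕ)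
  | get (a : ℕ) (i : Exp)
  | add (d e : Exp)
  | sub (d e : Exp)

/-- The value of an expression; `sub` is truncated subtraction. -/
def Exp.eval (s : State) : Exp → ℕ
  | .const k => k
  | .reg x => s.reg x
  | .get a i => s.arr a (i.eval s)
  | .add d e => d.eval s + e.eval s
  | .sub d e => d.eval s - e.eval s

/-- The cost of an evaluation: one step for every operation, constant and register access. -/
def Exp.cost : Exp → ℕ
  | .const _ => 1
  | .reg _ => 1
  | .get _ i => i.cost + 1
  | .add d e => d.cost + e.cost + 1
  | .sub d e => d.cost + e.cost + 1

/-- Programs. -/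
inductive Prog where
  /-- Do nothing. -/
  | skip
  /-- Write the value of `e` into register `x`. -/
  | assign (x : ℕ) (e : Exp)
  /-- Write the value of `e` into the cell of array `a` whose address is the value of `i`. -/
  | store (a : ℕ) (i e : Exp)
  /-- Run `c`, then `d`. -/
  | seq (c d : Prog)
  /-- Run `c` if the value of `e` is nonzero, and `d` otherwise. -/
  | cond (e : Exp) (c d : Prog)
  /-- Run `c` as long as the value of `e` is nonzero. -/
  | loop (e : Exp) (c : Prog)

/-- The state after writing `k` into register `x`. -/
def State.setReg (s : State) (x k : ℕ) : State :=
  { s with reg := fun y => if y = x then k else s.reg y }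

/-- The state after writing `k` into array `a` at address `i`. -/
def State.setArr (s : State) (a i k : ℕ) : State :=
  { s with arr := fun b j => if b = a ∧ j = i then k else s.arr b j }

/-- `Exec c s s' t`: the program `c`, started in the state `s`, halts in the state `s'` after
exactly `t` steps. -/
inductive Exec : Prog → State → State → ℕ → Prop
  | skip (s : State) : Exec .skip s s 1
  | assign (x : ℕ) (e : Exp) (s : State) :
      Exec (.assign x e) s (s.setReg x (e.eval s)) (e.cost + 1)
  | store (a : ℕ) (i e : Exp) (s : State) :
      Exec (.store a i e) s (s.setArr a (i.eval s) (e.eval s)) (i.cost + e.cost + 1)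
  | seq {c d : Prog} {s s' s'' : State} {t t' : ℕ} :
      Exec c s s' t → Exec d s' s'' t' → Exec (.seq c d) s s'' (t + t')
  | condTrue {e : Exp} {c d : Prog} {s s' : State} {t : ℕ} :
      e.eval s ≠ 0 → Exec c s s' t → Exec (.cond e c d) s s' (e.cost + t)
  | condFalse {e : Exp} {c d : Prog} {s s' : State} {t : ℕ} :
      e.eval s = 0 → Exec d s s' t → Exec (.cond e c d) s s' (e.cost + t)
  | loopTrue {e : Exp} {c : Prog} {s s' s'' : State} {t t' : ℕ} :
      e.eval s ≠ 0 → Exec c s s' t → Exec (.loop e c) s' s'' t' →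
        Exec (.loop e c) s s'' (e.cost + t + t')
  | loopFalse {e : Exp} {c : Prog} {s : State} :
      e.eval s = 0 → Exec (.loop e c) s s e.cost

/-- The machine is deterministic: final state and number of steps are determined by the program
and the initial state. -/
theorem Exec.unique {c : Prog} {s s₁ s₂ : State} {t₁ t₂ : ℕ}
    (h₁ : Exec c s s₁ t₁) (h₂ : Exec c s s₂ t₂) : s₁ = s₂ ∧ t₁ = t₂ := by
  induction h₁ generalizing s₂ t₂ with
  | skip s => cases h₂; exact ⟨rfl, rfl⟩
  | assign x e s => cases h₂; exact ⟨rfl, rfl⟩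
  | store a i e s => cases h₂; exact ⟨rfl, rfl⟩
  | seq _ _ ih ih' =>
    cases h₂ with
    | seq k k' =>
      obtain ⟨rfl, rfl⟩ := ih k
      obtain ⟨rfl, rfl⟩ := ih' k'
      exact ⟨rfl, rfl⟩
  | condTrue h _ ih =>
    cases h₂ with
    | condTrue _ k => obtain ⟨rfl, rfl⟩ := ih k; exact ⟨rfl, rfl⟩
    | condFalse h' _ => exact absurd h' h
  | condFalse h _ ih =>
    cases h₂ with
    | condTrue h' _ => exact absurd h h'
    | condFalse _ k => obtain ⟨rfl, rfl⟩ := ih k; exact ⟨rfl, rfl⟩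
  | loopTrue h _ _ ih ih' =>
    cases h₂ with
    | loopTrue _ k k' =>
      obtain ⟨rfl, rfl⟩ := ih k
      obtain ⟨rfl, rfl⟩ := ih' k'
      exact ⟨rfl, rfl⟩
    | loopFalse h' => exact absurd h' h
  | loopFalse h =>
    cases h₂ with
    | loopTrue h' _ _ => exact absurd h h'
    | loopFalse _ => exact ⟨rfl, rfl⟩

/-- The initial state on the input word `w`: its length is in register `0`, its entries are in
array `0`, and everything else is `0`. -/
def State.init (w : List ℕ) : State where
  reg x := if x = 0 then w.length else 0
  arr a i := if a = 0 then w.getD i 0 else 0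

/-- The output word: its length is in register `0` and its entries are in array `1`. -/
def State.output (s : State) : List ℕ :=
  (List.range (s.reg 0)).map (s.arr 1)

/-- On the input word `w` the program `c` halts with the output word `z` within `T` steps, where
each entry of the output word is charged one more step. -/
def OutputsWithin (c : Prog) (w z : List ℕ) (T : ℕ) : Prop :=
  ∃ (s : State) (t : ℕ), Exec c (State.init w) s t ∧ s.output = z ∧ t + z.length ≤ T

/-- The size of a word of natural numbers: the total number of bits, with one delimiter for each
entry. -/
def inputSize (w : List ℕ) : ℕ :=
  (w.map fun x => Nat.size x + 1).sum

end RAM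

/-! ### Max Rainbow Matching -/

/-- A finite simple graph (with vertices `0, …, n - 1`) together with an arbitrary, not necessarily
proper, edge coloring (with natural numbers as names of the colors). -/
structure EdgeColoredGraph where
  n : ℕ
  graph : SimpleGraph (Fin n)
  color : graph.EdgeLabeling ℕ

namespace EdgeColoredGraph

/-- A rainbow matching: a set of edges, no two of which have a common endvertex or a common
color. -/
def IsRainbowMatching (I : EdgeColoredGraph) (M : Finset I.graph.edgeSet) : Prop :=
  (∀ e ∈ M, ∀ f ∈ M, e ≠ f → ∀ v : Fin I.n, ¬ (v ∈ e.1 ∧ v ∈ f.1)) ∧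
    Set.InjOn I.color (M : Set I.graph.edgeSet)

/-- The number of edges in a largest rainbow matching. -/
noncomputable def opt (I : EdgeColoredGraph) : ℕ :=
  sSup {k : ℕ | ∃ M : Finset I.graph.edgeSet, I.IsRainbowMatching M ∧ M.card = k}

/-- The value `opt` is attained, and it is an upper bound. -/
theorem isGreatest_opt (I : EdgeColoredGraph) :
    IsGreatest {k : ℕ | ∃ M : Finset I.graph.edgeSet, I.IsRainbowMatching M ∧ M.card = k}
      I.opt := by
  have hb : BddAbove
      {k : ℕ | ∃ M : Finset I.graph.edgeSet, I.IsRainbowMatching M ∧ M.card = k} := by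
    refine ⟨Nat.card I.graph.edgeSet, ?_⟩
    rintro k ⟨M, -, rfl⟩
    rw [← Set.ncard_coe_finset, ← Set.ncard_univ]
    exact Set.ncard_le_ncard (Set.subset_univ _) Set.finite_univ
  refine ⟨Nat.sSup_mem ⟨0, ∅, ⟨by simp, fun e he => by simp at he⟩, rfl⟩ hb,
    fun k hk => le_csSup hb hk⟩

/-- The word `w` represents the edge-colored graph: it consists of the number of vertices and of
one triple `u, v, c` for each edge `uv` of color `c`. The edges may come in any order, and each of
them in any of its two orientations. -/
def IsEncoding (I : EdgeColoredGraph) (w : List ℕ) : Prop :=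
  ∃ L : List (Fin I.n × Fin I.n × ℕ),
    w = I.n :: L.flatMap (fun t => [(t.1 : ℕ), (t.2.1 : ℕ), t.2.2]) ∧
    (L.map fun t => s(t.1, t.2.1)).Nodup ∧
    (∀ t ∈ L, ∃ h : s(t.1, t.2.1) ∈ I.graph.edgeSet, I.color ⟨s(t.1, t.2.1), h⟩ = t.2.2) ∧
    ∀ e ∈ I.graph.edgeSet, e ∈ L.map fun t => s(t.1, t.2.1)

/-- The word `z` lists the edges of `M`, each of them once and as a pair `u, v` of endvertices. -/
def IsEdgeList (I : EdgeColoredGraph) (M : Finset I.graph.edgeSet) (z : List ℕ) : Prop :=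
  ∃ L : List (Fin I.n × Fin I.n),
    z = L.flatMap (fun p => [(p.1 : ℕ), (p.2 : ℕ)]) ∧
    (L.map fun p => s(p.1, p.2)).Nodup ∧
    ∀ e : Sym2 (Fin I.n), (e ∈ L.map fun p => s(p.1, p.2)) ↔ ∃ f ∈ M, f.1 = e

end EdgeColoredGraph

/-- The program `P` is a polynomial-time algorithm with approximation ratio `α` for Max Rainbow
Matching: on every representation of every instance it outputs a rainbow matching with at least
`α * opt` edges, in a number of steps bounded by a polynomial in the size of the input. -/
def IsPolyTimeApproxForMaxRainbowMatching (P : RAM.Prog) (α : ℝ) : Prop :=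
  ∃ p : Polynomial ℕ, ∀ (I : EdgeColoredGraph) (w : List ℕ), I.IsEncoding w →
    ∃ (M : Finset I.graph.edgeSet) (z : List ℕ),
      RAM.OutputsWithin P w z (p.eval (RAM.inputSize w)) ∧
      I.IsEdgeList M z ∧
      I.IsRainbowMatching M ∧
      α * (I.opt : ℝ) ≤ (M.card : ℝ)

/-! Each edge becomes a set of at most three points: its two endvertices and its color, with
vertices and colors kept apart. Rainbow matchings are then exactly the packings of pairwise disjoint
sets (`isRainbowMatching_iff`), so the problem is a case of 3-set packing. It is solved by local
search: adding up to K edges and discarding whatever they meet, whenever this enlarges the packing.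
K depends on ε only, so all K-tuples of edges can be tried in polynomial time; as every change
raises the cardinality, m sweeps reach a local optimum when there are m edges (`sweep_search`).

For the ratio, join each member of an optimal packing B to the members of the local optimum A that
it meets. All degrees are at most three, and by local optimality no small subset of B has fewer
neighbours than members (`card_le_card_of_locally_optimal`). In `card_le_of_locally_expanding` a
part D of B, matched injectively into A, grows in rounds. A member of B outside D has an unmatched
neighbour, and two members with just one each have different ones; otherwise a small subset of B
would have too few neighbours. So all those with just one can join D. If 2n|B| > (3n+1)|A|, double
counting shows that more than |A|/n join in each round, and D outgrows A. The small subsets grow at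
most fourfold per round, whence K = 2 * 4 ^ (n + 1).

On the machine, `RunsAs` pairs a program with an exact state transformation and a polynomial time
bound; correctness then means that arrays hold the characteristic functions of the abstract
packings. -/

section LocalSearchBound

/-! ### Local optima in bipartite graphs of maximum degree three -/

variable {ι κ : Type*} [DecidableEq κ]

/-- `D` is matched injectively by `p` into the other side in such a way that each of its members
lies in a set of at most `q` members all of whose neighbours are matched inside this set. -/
structure PeeledBy (B : Finset ι) (N : ι → Finset κ) (q : ℕ) (D : Finset ι) (p : ι → κ) :
    Prop where
  subset : D ⊆ B
  mem : ∀ d ∈ D, p d ∈ N d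
  injOn : Set.InjOn p D
  closed : ∀ d ∈ D, ∃ C ⊆ D, d ∈ C ∧ C.card ≤ q ∧ C.biUnion N ⊆ C.image p

theorem PeeledBy.card_le {A : Finset κ} {B : Finset ι} {N : ι → Finset κ} {q : ℕ} {D : Finset ι}
    {p : ι → κ} (h : PeeledBy B N q D p) (hN : ∀ b ∈ B, N b ⊆ A) : D.card ≤ A.card :=
  Finset.card_le_card_of_injOn p (fun d hd => hN d (h.subset hd) (h.mem d hd)) h.injOn

variable [DecidableEq ι]

/-- The union of the closed sets around the partners of `T` is again closed; the bound three on `T`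
comes from the degree, since `T` will consist of matched neighbours of one member of `B`. -/
theorem PeeledBy.gather {B : Finset ι} {N : ι → Finset κ} {q : ℕ} {D : Finset ι} {p : ι → κ}
    (h : PeeledBy B N q D p) {T : Finset κ} (hT : T ⊆ D.image p) (hc : T.card ≤ 3) :
    ∃ C ⊆ D, C.card ≤ 3 * q ∧ T ⊆ C.image p ∧ C.biUnion N ⊆ C.image p := by
  have key : ∀ a : κ, ∃ C : Finset ι, a ∈ T →
      C ⊆ D ∧ a ∈ C.image p ∧ C.card ≤ q ∧ C.biUnion N ⊆ C.image p := by
    intro a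
    by_cases ha : a ∈ T
    · obtain ⟨d, hd, rfl⟩ := Finset.mem_image.1 (hT ha)
      obtain ⟨C, h1, h2, h3, h4⟩ := h.closed d hd
      exact ⟨C, fun _ => ⟨h1, Finset.mem_image_of_mem p h2, h3, h4⟩⟩
    · exact ⟨∅, fun h => absurd h ha⟩
  choose C hC using key
  refine ⟨T.biUnion C, ?_, ?_, ?_, ?_⟩
  · exact Finset.biUnion_subset.2 fun a ha => (hC a ha).1
  · exact (Finset.card_biUnion_le_card_mul _ _ _ fun a ha => (hC a ha).2.2.1).trans
      (Nat.mul_le_mul_right _ hc)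
  · intro a ha
    exact Finset.image_subset_image (Finset.subset_biUnion_of_mem C ha) (hC a ha).2.1
  · refine Finset.biUnion_subset.2 fun b hb => ?_
    obtain ⟨a, ha, hba⟩ := Finset.mem_biUnion.1 hb
    exact ((Finset.subset_biUnion_of_mem N hba).trans (hC a ha).2.2.2).trans
      (Finset.image_subset_image (Finset.subset_biUnion_of_mem C ha))

/-- If all neighbours of `b` were matched, `b` together with the closed set gathered around them
would have one member more than it has neighbours. -/
theorem PeeledBy.nonempty_sdiff {B : Finset ι} {N : ι → Finset κ} {q : ℕ} {D : Finset ι}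
    {p : ι → κ} (h : PeeledBy B N q D p) (hb : ∀ b ∈ B, (N b).card ≤ 3)
    (hloc : ∀ C ⊆ B, C.card ≤ 2 + 6 * q → C.card ≤ (C.biUnion N).card)
    {b : ι} (hbB : b ∈ B) (hbD : b ∉ D) : (N b \ D.image p).Nonempty := by
  rw [Finset.nonempty_iff_ne_empty, Ne, Finset.sdiff_eq_empty_iff_subset]
  intro hs
  obtain ⟨C, h1, h2, h3, h4⟩ := h.gather hs (hb b hbB)
  have hbC : b ∉ C := fun hh => hbD (h1 hh)
  have := hloc (insert b C) (Finset.insert_subset hbB (h1.trans h.subset))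
    (by rw [Finset.card_insert_of_notMem hbC]; omega)
  rw [Finset.biUnion_insert, Finset.card_insert_of_notMem hbC] at this
  have h5 := (Finset.card_le_card (Finset.union_subset h3 h4)).trans Finset.card_image_le
  omega

/-- If `b ≠ c` shared their only unmatched neighbour `a`, adding both to the closed sets gathered
around their matched neighbours would give two more members but only one more neighbour. This is
where `2 + 6 * q` comes from: two members and twice `3 * q`. -/
theorem PeeledBy.injOn_of_unique {B : Finset ι} {N : ι → Finset κ} {q : ℕ} {D : Finset ι}
    {p : ι → κ} (h : PeeledBy B N q D p) (hb : ∀ b ∈ B, (N b).card ≤ 3)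
    (hloc : ∀ C ⊆ B, C.card ≤ 2 + 6 * q → C.card ≤ (C.biUnion N).card)
    {b c : ι} (hbB : b ∈ B) (hbD : b ∉ D) (hcB : c ∈ B) (hcD : c ∉ D) {a : κ}
    (hba : N b \ D.image p = {a}) (hca : N c \ D.image p = {a}) : b = c := by
  by_contra hne
  obtain ⟨C, h1, h2, h3, h4⟩ := h.gather (T := N b ∩ D.image p) Finset.inter_subset_right
    ((Finset.card_le_card Finset.inter_subset_left).trans (hb b hbB))
  obtain ⟨C', h1', h2', h3', h4'⟩ := h.gather (T := N c ∩ D.image p) Finset.inter_subset_right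
    ((Finset.card_le_card Finset.inter_subset_left).trans (hb c hcB))
  have hbC : b ∉ insert c (C ∪ C') := by
    simp only [Finset.mem_insert, Finset.mem_union, not_or]
    exact ⟨hne, fun hh => hbD (h1 hh), fun hh => hbD (h1' hh)⟩
  have hcC : c ∉ C ∪ C' := by
    simp only [Finset.mem_union, not_or]
    exact ⟨fun hh => hcD (h1 hh), fun hh => hcD (h1' hh)⟩
  have hcard : (insert b (insert c (C ∪ C'))).card = (C ∪ C').card + 2 := by
    rw [Finset.card_insert_of_notMem hbC, Finset.card_insert_of_notMem hcC]
  have hu := Finset.card_union_le C C'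
  have := hloc (insert b (insert c (C ∪ C')))
    (Finset.insert_subset hbB (Finset.insert_subset hcB
      ((Finset.union_subset h1 h1').trans h.subset))) (by omega)
  have hsub : (insert b (insert c (C ∪ C'))).biUnion N ⊆ insert a ((C ∪ C').image p) := by
    rw [Finset.biUnion_insert, Finset.biUnion_insert, Finset.image_union]
    intro x hx
    have hsplit : ∀ d, N d \ D.image p = {a} → x ∈ N d → x = a ∨ x ∈ N d ∩ D.image p := by
      intro d hd hxd
      by_cases hxD : x ∈ D.image p
      · exact Or.inr (Finset.mem_inter.2 ⟨hxd, hxD⟩)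
      · exact Or.inl (Finset.mem_singleton.1 (hd ▸ Finset.mem_sdiff.2 ⟨hxd, hxD⟩))
    rw [Finset.mem_insert, Finset.mem_union]
    rcases Finset.mem_union.1 hx with hx | hx
    · exact (hsplit b hba hx).imp_right fun hh => Or.inl (h3 hh)
    rcases Finset.mem_union.1 hx with hx | hx
    · exact (hsplit c hca hx).imp_right fun hh => Or.inr (h3' hh)
    · obtain ⟨d, hd, hxd⟩ := Finset.mem_biUnion.1 hx
      rcases Finset.mem_union.1 hd with hd | hd
      · exact Or.inr (Or.inl (h4 (Finset.mem_biUnion.2 ⟨d, hd, hxd⟩)))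
      · exact Or.inr (Or.inr (h4' (Finset.mem_biUnion.2 ⟨d, hd, hxd⟩)))
  have h5 := Finset.card_le_card hsub
  have h6 := Finset.card_insert_le a ((C ∪ C').image p)
  have h7 : ((C ∪ C').image p).card ≤ (C ∪ C').card := Finset.card_image_le
  omega

/-- The members of `B` outside `D` with exactly one unmatched neighbour can be matched to it. -/
theorem PeeledBy.extend {B : Finset ι} {N : ι → Finset κ} {q : ℕ} {D : Finset ι}
    {p : ι → κ} (h : PeeledBy B N q D p) (hb : ∀ b ∈ B, (N b).card ≤ 3)
    (hloc : ∀ C ⊆ B, C.card ≤ 2 + 6 * q → C.card ≤ (C.biUnion N).card) :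
    ∃ p', PeeledBy B N (1 + 3 * q)
      (D ∪ (B \ D).filter fun b => (N b \ D.image p).card = 1) p' := by
  set E := (B \ D).filter fun b => (N b \ D.image p).card = 1 with hE
  have hEm : ∀ b ∈ E, b ∈ B ∧ b ∉ D := fun b hbE =>
    Finset.mem_sdiff.1 (Finset.mem_filter.1 hbE).1
  have key : ∀ b, ∃ a, b ∈ E → N b \ D.image p = {a} := by
    intro b
    by_cases hbE : b ∈ E
    · obtain ⟨a, ha⟩ := Finset.card_eq_one.1 (Finset.mem_filter.1 hbE).2
      exact ⟨a, fun _ => ha⟩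
    · by_cases hn : Nonempty κ
      · exact ⟨hn.some, fun hh => absurd hh hbE⟩
      · exact ⟨p b, fun hh => absurd hh hbE⟩
  choose f hf using key
  have hfm : ∀ b ∈ E, f b ∈ N b ∧ f b ∉ D.image p := fun b hbE =>
    Finset.mem_sdiff.1 (hf b hbE ▸ Finset.mem_singleton_self _)
  have hpD : ∀ b ∈ D, (if b ∈ D then p b else f b) = p b := fun b hbD => if_pos hbD
  have hpE : ∀ b ∈ E, (if b ∈ D then p b else f b) = f b := fun b hbE => if_neg (hEm b hbE).2
  have himg : ∀ C ⊆ D, C.image (fun b => if b ∈ D then p b else f b) = C.image p :=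
    fun C hC => Finset.image_congr fun b hbC => hpD b (hC hbC)
  refine ⟨fun b => if b ∈ D then p b else f b, ?_, ?_, ?_, ?_⟩
  · exact Finset.union_subset h.subset fun b hbE => (hEm b hbE).1
  · intro d hd
    rcases Finset.mem_union.1 hd with hd | hd
    · simpa only [hpD d hd] using h.mem d hd
    · simpa only [hpE d hd] using (hfm d hd).1
  · intro b hbm c hcm hbc
    simp only at hbc
    rcases Finset.mem_union.1 hbm with hb1 | hb1 <;> rcases Finset.mem_union.1 hcm with hc1 | hc1
    · rw [hpD b hb1, hpD c hc1] at hbc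
      exact h.injOn hb1 hc1 hbc
    · rw [hpD b hb1, hpE c hc1] at hbc
      exact absurd (hbc ▸ Finset.mem_image_of_mem p hb1) (hfm c hc1).2
    · rw [hpE b hb1, hpD c hc1] at hbc
      exact absurd (hbc ▸ Finset.mem_image_of_mem p hc1) (hfm b hb1).2
    · rw [hpE b hb1, hpE c hc1] at hbc
      exact h.injOn_of_unique hb hloc (hEm b hb1).1 (hEm b hb1).2 (hEm c hc1).1 (hEm c hc1).2
        (hf b hb1) (hbc ▸ hf c hc1)
  · intro d hd
    rcases Finset.mem_union.1 hd with hd | hd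
    · obtain ⟨C, h1, h2, h3, h4⟩ := h.closed d hd
      exact ⟨C, h1.trans Finset.subset_union_left, h2, by omega, (himg C h1).symm ▸ h4⟩
    · obtain ⟨C, h1, h2, h3, h4⟩ := h.gather (T := N d ∩ D.image p) Finset.inter_subset_right
        ((Finset.card_le_card Finset.inter_subset_left).trans (hb d (hEm d hd).1))
      refine ⟨insert d C, Finset.insert_subset (Finset.mem_union_right _ hd)
        (h1.trans Finset.subset_union_left), Finset.mem_insert_self _ _, ?_, ?_⟩
      · have := Finset.card_insert_le d C
        omega
      · rw [Finset.biUnion_insert, Finset.image_insert, himg C h1, hpE d hd]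
        intro x hx
        rw [Finset.mem_insert]
        rcases Finset.mem_union.1 hx with hx | hx
        · by_cases hxD : x ∈ D.image p
          · exact Or.inr (h3 (Finset.mem_inter.2 ⟨hx, hxD⟩))
          · exact Or.inl (Finset.mem_singleton.1 (hf d hd ▸ Finset.mem_sdiff.2 ⟨hx, hxD⟩))
        · exact Or.inr (h4 hx)

/-- Double counting of the adjacent pairs outside the matched parts. -/
theorem PeeledBy.two_mul_card_le {A : Finset κ} {B : Finset ι} {N : ι → Finset κ} {q : ℕ}
    {D : Finset ι} {p : ι → κ} (h : PeeledBy B N q D p) (hN : ∀ b ∈ B, N b ⊆ A)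
    (hb : ∀ b ∈ B, (N b).card ≤ 3)
    (ha : ∀ a ∈ A, (B.filter fun b => a ∈ N b).card ≤ 3)
    (hloc : ∀ C ⊆ B, C.card ≤ 2 + 6 * q → C.card ≤ (C.biUnion N).card) :
    2 * B.card ≤ 3 * A.card + ((B \ D).filter fun b => (N b \ D.image p).card = 1).card := by
  set S := D.image p with hS
  set E := (B \ D).filter fun b => (N b \ S).card = 1 with hE
  have hSA : S ⊆ A := by
    intro x hx
    obtain ⟨d, hd, rfl⟩ := Finset.mem_image.1 hx
    exact hN d (h.subset hd) (h.mem d hd)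
  have hSc : S.card = D.card := Finset.card_image_of_injOn h.injOn
  have h1 : ∑ b ∈ B \ D, (N b \ S).card ≤ 3 * (A \ S).card := by
    have hswap : ∑ b ∈ B \ D, (N b \ S).card
        = ∑ a ∈ A \ S, ((B \ D).filter fun b => a ∈ N b).card := by
      refine Eq.trans ?_ (Finset.sum_card_bipartiteAbove_eq_sum_card_bipartiteBelow
        (s := B \ D) (t := A \ S) (fun b a => a ∈ N b))
      refine Finset.sum_congr rfl fun b hbm => ?_
      congr 1
      ext x
      simp only [Finset.bipartiteAbove, Finset.mem_filter, Finset.mem_sdiff]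
      have := @hN b (Finset.mem_sdiff.1 hbm).1 x
      tauto
    rw [hswap, mul_comm]
    refine (Finset.sum_le_card_nsmul _ _ 3 fun a hA => ?_).trans_eq (by simp)
    exact (Finset.card_le_card (Finset.filter_subset_filter _ Finset.sdiff_subset)).trans
      (ha a (Finset.mem_sdiff.1 hA).1)
  -- Each `b` outside `D` has at least one unmatched neighbour; if it has only one, its membership
  -- in `E` supplies the missing unit.
  have h2 : 2 * (B \ D).card ≤ ∑ b ∈ B \ D, (N b \ S).card + E.card := by
    rw [hE, Finset.card_filter, ← Finset.sum_add_distrib, mul_comm, ← smul_eq_mul]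
    refine Finset.card_nsmul_le_sum _ _ 2 fun b hbm => ?_
    obtain ⟨hbB, hbD⟩ := Finset.mem_sdiff.1 hbm
    have := (h.nonempty_sdiff hb hloc hbB hbD).card_pos
    rw [← hS] at this
    split_ifs <;> omega
  rw [Finset.card_sdiff_of_subset h.subset] at h2
  rw [Finset.card_sdiff_of_subset hSA] at h1
  have h3 := Finset.card_le_card h.subset
  have h4 := Finset.card_le_card hSA
  omega

/-- In a bipartite graph with maximum degree three such that no small subset of the side `B` has
fewer neighbours than elements, `B` has at most about `3 / 2` times as many elements as `A`. -/
theorem card_le_of_locally_expanding {A : Finset κ} {B : Finset ι} {N : ι → Finset κ} (n : ℕ)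
    (hN : ∀ b ∈ B, N b ⊆ A) (hb : ∀ b ∈ B, (N b).card ≤ 3)
    (ha : ∀ a ∈ A, (B.filter fun b => a ∈ N b).card ≤ 3)
    (hloc : ∀ C ⊆ B, C.card ≤ 2 * 4 ^ (n + 1) → C.card ≤ (C.biUnion N).card) :
    2 * n * B.card ≤ (3 * n + 1) * A.card := by
  by_contra! hlt
  have hn : 0 < n := Nat.pos_of_ne_zero fun h => by simp [h] at hlt
  -- An element of `A` is needed as the junk value of the initial matching on the empty set.
  have hA : A.Nonempty ∨ B = ∅ := by
    rcases B.eq_empty_or_nonempty with h | ⟨b, hbB⟩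
    · exact Or.inr h
    · have := hloc {b} (by simpa using hbB)
        (by simp only [Finset.card_singleton]
            have : 0 < 4 ^ (n + 1) := by positivity
            omega)
      simp only [Finset.card_singleton, Finset.singleton_biUnion] at this
      exact Or.inl ((Finset.card_pos.1 this).mono (hN b hbB))
  have key : ∀ i ≤ n + 1, ∃ D p, PeeledBy B N (4 ^ i - 1) D p ∧ i * A.card ≤ n * D.card ∧
      (0 < i → i * A.card < n * D.card) := by
    intro i
    induction i with
    | zero =>
      intro _
      rcases hA with ⟨a, _⟩ | rfl
      · exact ⟨∅, fun _ => a, ⟨by simp, by simp, by simp, by simp⟩, by simp, by simp⟩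
      · simp at hlt
    | succ i ih =>
      intro hi
      obtain ⟨D, p, h, hc, _⟩ := ih (by omega)
      -- Here `i ≤ n`, and `6 * 4 ^ i - 4` is at most `8 * 4 ^ n`.
      have hq : 2 + 6 * (4 ^ i - 1) ≤ 2 * 4 ^ (n + 1) := by
        have h1 : 4 ^ i ≤ 4 ^ n := Nat.pow_le_pow_right (by norm_num) (by omega)
        have h2 : 0 < 4 ^ i := by positivity
        rw [pow_succ]; omega
      have hloc' : ∀ C ⊆ B, C.card ≤ 2 + 6 * (4 ^ i - 1) → C.card ≤ (C.biUnion N).card :=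
        fun C hC hcc => hloc C hC (hcc.trans hq)
      have h2 := h.two_mul_card_le hN hb ha hloc'
      obtain ⟨p', h'⟩ := h.extend hb hloc'
      set E := (B \ D).filter fun b => (N b \ D.image p).card = 1 with hE
      have hdisj : Disjoint D E :=
        Finset.disjoint_left.2 fun d hd hdE =>
          (Finset.mem_sdiff.1 (Finset.mem_filter.1 hdE).1).2 hd
      -- Multiplying the double count by `n` gives `(3n+1)|A| < 2n|B| ≤ 3n|A| + n|E|`.
      have hAE : A.card < n * E.card := by
        nlinarith
      refine ⟨D ∪ E, p', ⟨h'.subset, h'.mem, h'.injOn, fun d hd => ?_⟩, ?_, fun _ => ?_⟩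
      · obtain ⟨C, h1, h2, h3, h4⟩ := h'.closed d hd
        -- The recursion `q ↦ 1 + 3 * q` stays below `4 ^ i - 1`.
        refine ⟨C, h1, h2, h3.trans ?_, h4⟩
        have h2 : 0 < 4 ^ i := by positivity
        rw [pow_succ]; omega
      · rw [Finset.card_union_of_disjoint hdisj]; nlinarith
      · rw [Finset.card_union_of_disjoint hdisj]; nlinarith
  obtain ⟨D, p, h, hc, hs⟩ := key (n + 1) le_rfl
  have h1 := h.card_le hN
  have h2 := hs (by omega)
  nlinarith

end LocalSearchBound

/-! ### Running times and invariants of machine programs -/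

namespace RAM

/-- The program `c` computes the state transformation `F`, preserves register `0`, and the number
of its steps is bounded by a polynomial in the contents of register `0`. -/
def RunsAs (c : Prog) (F : State → State) : Prop :=
  ∃ p : Polynomial ℕ, ∀ s, ∃ t ≤ p.eval (s.reg 0), Exec c s (F s) t ∧ (F s).reg 0 = s.reg 0

theorem runsAs_skip : RunsAs .skip id :=
  ⟨1, fun s => ⟨1, by simp, .skip s, rfl⟩⟩

theorem runsAs_assign {x : ℕ} (hx : x ≠ 0) (e : Exp) :
    RunsAs (.assign x e) fun s => s.setReg x (e.eval s) :=
  ⟨.C (e.cost + 1), fun s => ⟨e.cost + 1, by simp only [Polynomial.eval_C, le_refl],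
    .assign x e s, if_neg hx.symm⟩⟩

theorem runsAs_store (a : ℕ) (i e : Exp) :
    RunsAs (.store a i e) fun s => s.setArr a (i.eval s) (e.eval s) :=
  ⟨.C (i.cost + e.cost + 1), fun s => ⟨i.cost + e.cost + 1,
    by simp only [Polynomial.eval_C, le_refl], .store a i e s, rfl⟩⟩

theorem RunsAs.seq {c d : Prog} {F G : State → State} (hc : RunsAs c F) (hd : RunsAs d G) :
    RunsAs (.seq c d) fun s => G (F s) := by
  obtain ⟨p, hp⟩ := hc
  obtain ⟨q, hq⟩ := hd
  refine ⟨p + q, fun s => ?_⟩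
  obtain ⟨t, ht, h1, h2⟩ := hp s
  obtain ⟨t', ht', h1', h2'⟩ := hq (F s)
  rw [h2] at ht' h2'
  exact ⟨t + t', by rw [Polynomial.eval_add]; omega, .seq h1 h1', h2'⟩

theorem RunsAs.cond (e : Exp) {c d : Prog} {F G : State → State} (hc : RunsAs c F)
    (hd : RunsAs d G) :
    RunsAs (.cond e c d) fun s => if e.eval s ≠ 0 then F s else G s := by
  obtain ⟨p, hp⟩ := hc
  obtain ⟨q, hq⟩ := hd
  refine ⟨.C e.cost + p + q, fun s => ?_⟩
  simp only [Polynomial.eval_add, Polynomial.eval_C]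
  by_cases h : e.eval s ≠ 0
  · obtain ⟨t, ht, h1, h2⟩ := hp s
    simp only [if_pos h]
    exact ⟨e.cost + t, by omega, .condTrue h h1, h2⟩
  · obtain ⟨t, ht, h1, h2⟩ := hq s
    simp only [if_neg h]
    exact ⟨e.cost + t, by omega, .condFalse (not_not.1 h) h1, h2⟩

/-- Run `c` with the values `1, 4, 7, …` in register `x`, as long as they are below the contents of
register `0`. -/
def Prog.forEach (x : ℕ) (c : Prog) : Prog :=
  .seq (.assign x (.const 1)) (.loop (.sub (.reg 0) (.reg x))
    (.seq c (.assign x (.add (.reg x) (.const 3)))))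

/-- One round of `Prog.forEach`. -/
def forStep (x : ℕ) (F : State → State) (s : State) : State :=
  (F s).setReg x ((F s).reg x + 3)

/-- The state transformation computed by `Prog.forEach`. -/
def forRun (x : ℕ) (F : State → State) (s : State) : State :=
  -- The exponent is the number of values 1, 4, 7, … below the contents of register `0`; it is `m`
  -- for a word of length `1 + 3 * m`.
  (forStep x F)^[(s.reg 0 + 1) / 3] (s.setReg x 1)

/-- The body changes neither the bound in register `0` nor the loop variable, so the number of
rounds is fixed in advance and each round obeys the same time bound. Nesting loops to a constant
depth therefore stays polynomial. -/
theorem RunsAs.forEach {x : ℕ} (hx : x ≠ 0) {c : Prog} {F : State → State} (hc : RunsAs c F)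
    (hF : ∀ s, (F s).reg x = s.reg x) : RunsAs (.forEach x c) (forRun x F) := by
  obtain ⟨p, hp⟩ := hc
  have hloop : ∀ k s, (s.reg 0 - s.reg x + 2) / 3 = k →
      ∃ t ≤ k * (p.eval (s.reg 0) + 7) + 3,
        Exec (.loop (.sub (.reg 0) (.reg x))
          (.seq c (.assign x (.add (.reg x) (.const 3))))) s ((forStep x F)^[k] s) t ∧
        ((forStep x F)^[k] s).reg 0 = s.reg 0 := by
    intro k
    induction k with
    | zero =>
      intro s hk
      exact ⟨3, by simp, .loopFalse (e := .sub (.reg 0) (.reg x))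
        (by simp only [Exp.eval]; omega), rfl⟩
    | succ k ih =>
      intro s hk
      obtain ⟨t, ht, h1, h2⟩ := hp s
      have h0 : (forStep x F s).reg 0 = s.reg 0 := by
        simp only [forStep, State.setReg, if_neg hx.symm, h2]
      have hxr : (forStep x F s).reg x = s.reg x + 3 := by
        simp only [forStep, State.setReg, if_true, hF]
      obtain ⟨t', ht', h1', h2'⟩ := ih (forStep x F s) (by rw [h0, hxr]; omega)
      rw [h0] at ht' h2'
      rw [Function.iterate_succ_apply]
      -- Three steps for the test and four for the increment.
      refine ⟨3 + (t + 4) + t', ?_, .loopTrue (e := .sub (.reg 0) (.reg x))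
        (by simp only [Exp.eval]; omega) (.seq h1 (.assign x _ _)) h1', h2'⟩
      rw [Nat.succ_mul]
      omega
  refine ⟨(.X + 1) * (p + 7) + 5, fun s => ?_⟩
  have h0 : (s.setReg x 1).reg 0 = s.reg 0 := if_neg hx.symm
  obtain ⟨t, ht, h1, h2⟩ := hloop ((s.reg 0 + 1) / 3) (s.setReg x 1) (by
    rw [h0]; simp only [State.setReg, if_true]; omega)
  rw [h0] at ht h2
  refine ⟨2 + t, ?_, .seq (.assign x (.const 1) s) h1, h2⟩
  have h3 : (s.reg 0 + 1) / 3 * (p.eval (s.reg 0) + 7) ≤ (s.reg 0 + 1) * (p.eval (s.reg 0) + 7) :=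
    Nat.mul_le_mul_right _ (Nat.div_le_self _ _)
  have h5 : (7 : Polynomial ℕ).eval (s.reg 0) = 7 := Polynomial.eval_natCast
  have h6 : (5 : Polynomial ℕ).eval (s.reg 0) = 5 := Polynomial.eval_natCast
  simp only [Polynomial.eval_add, Polynomial.eval_mul, Polynomial.eval_X, Polynomial.eval_one,
    h5, h6]
  omega

/-- The invariant rule for `Prog.forEach`. -/
theorem forRun_induction {x m : ℕ} {F : State → State} {s : State}
    (hF : ∀ s, (F s).reg x = s.reg x) (hm : s.reg 0 = 1 + 3 * m) (P : ℕ → State → Prop)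
    (h0 : P 0 (s.setReg x 1))
    (hs : ∀ i < m, ∀ s, P i s → s.reg x = 1 + 3 * i →
      P (i + 1) ((F s).setReg x (1 + 3 * (i + 1)))) : P m (forRun x F s) := by
  have key : ∀ i ≤ m, P i ((forStep x F)^[i] (s.setReg x 1)) ∧
      ((forStep x F)^[i] (s.setReg x 1)).reg x = 1 + 3 * i := by
    intro i
    induction i with
    | zero => exact fun _ => ⟨h0, if_pos rfl⟩
    | succ i ih =>
      intro hi
      obtain ⟨h1, h2⟩ := ih (by omega)
      rw [Function.iterate_succ_apply']
      set s' := (forStep x F)^[i] (s.setReg x 1)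
      have h3 : forStep x F s' = (F s').setReg x (1 + 3 * (i + 1)) := by
        rw [forStep, hF, h2, mul_add, add_assoc]
      rw [h3]
      exact ⟨hs i (by omega) s' h1 h2, if_pos rfl⟩
  have h : (s.reg 0 + 1) / 3 = m := by omega
  rw [forRun, h]
  exact (key m le_rfl).1

theorem forRun_reg {x y : ℕ} (hxy : y ≠ x) {F : State → State}
    (hF : ∀ s, (F s).reg y = s.reg y) (s : State) : (forRun x F s).reg y = s.reg y := by
  have key : ∀ k s, ((forStep x F)^[k] s).reg y = s.reg y := by
    intro k
    induction k with
    | zero => exact fun _ => rfl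
    | succ k ih =>
      intro s
      rw [Function.iterate_succ_apply, ih]
      simp only [forStep, State.setReg, if_neg hxy, hF]
  rw [forRun, key]
  simp only [State.setReg, if_neg hxy]

theorem forRun_arr {x a : ℕ} {F : State → State}
    (hF : ∀ s, (F s).arr a = s.arr a) (s : State) : (forRun x F s).arr a = s.arr a := by
  have key : ∀ k s, ((forStep x F)^[k] s).arr a = s.arr a := by
    intro k
    induction k with
    | zero => exact fun _ => rfl
    | succ k ih =>
      intro s
      rw [Function.iterate_succ_apply, ih]
      simp only [forStep, State.setReg, hF]
  rw [forRun, key]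
  rfl

/-- The state transformation `arr a (reg 1) := e`. -/
def storeAt (a : ℕ) (e : Exp) (s : State) : State := s.setArr a (s.reg 1) (e.eval s)

theorem runsAs_forEach_store (a : ℕ) (e : Exp) :
    RunsAs (.forEach 1 (.store a (.reg 1) e)) (forRun 1 (storeAt a e)) :=
  (runsAs_store a (.reg 1) e).forEach one_ne_zero fun _ => rfl

theorem forRun_storeAt_reg (a : ℕ) (e : Exp) {y : ℕ} (hy : y ≠ 1) (s : State) :
    (forRun 1 (storeAt a e) s).reg y = s.reg y :=
  forRun_reg (F := storeAt a e) hy (fun _ => rfl) s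

theorem forRun_storeAt_arr {a b : ℕ} (e : Exp) (hb : b ≠ a) (s : State) :
    (forRun 1 (storeAt a e) s).arr b = s.arr b :=
  forRun_arr (fun s => by funext j; simp [storeAt, State.setArr, hb]) s

/-- An array may be updated in place: when a cell is computed, that cell, the other arrays and all
registers but the loop variable still have their original contents, and `e` has to be evaluated from
these alone. -/
theorem forRun_storeAt {a m : ℕ} {e : Exp} {s : State} (hm : s.reg 0 = 1 + 3 * m) (v : ℕ → ℕ)
    (hv : ∀ i < m, ∀ s' : State, (∀ y ≠ 1, s'.reg y = s.reg y) → (∀ b ≠ a, s'.arr b = s.arr b) →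
      s'.arr a (1 + 3 * i) = s.arr a (1 + 3 * i) → s'.reg 1 = 1 + 3 * i → e.eval s' = v i) :
    ∀ i < m, (forRun 1 (storeAt a e) s).arr a (1 + 3 * i) = v i := by
  refine (forRun_induction (F := storeAt a e) (fun _ => rfl) hm (fun i s' =>
    (∀ y ≠ 1, s'.reg y = s.reg y) ∧ (∀ b ≠ a, s'.arr b = s.arr b) ∧
    (∀ k < i, s'.arr a (1 + 3 * k) = v k) ∧
    (∀ k, i ≤ k → s'.arr a (1 + 3 * k) = s.arr a (1 + 3 * k))) ?_ ?_).2.2.1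
  · exact ⟨fun y hy => if_neg hy, fun _ _ => rfl, fun k hk => absurd hk (Nat.not_lt_zero k),
      fun _ _ => rfl⟩
  · rintro i hi s' ⟨h1, h2, h3, h4⟩ hr
    have he := hv i hi s' h1 h2 (h4 i le_rfl) hr
    refine ⟨fun y hy => ?_, fun b hb => ?_, fun k hk => ?_, fun k hk => ?_⟩
    · simp [State.setReg, storeAt, State.setArr, hy, h1]
    · funext j
      simp [State.setReg, storeAt, State.setArr, hb, h2]
    · simp only [State.setReg, storeAt, State.setArr, hr, he, true_and]
      split_ifs with hki
      · congr 1; omega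
      · exact h3 k (by omega)
    · simp only [State.setReg, storeAt, State.setArr, hr, true_and]
      rw [if_neg (by omega)]
      exact h4 k (by omega)

end RAM

/-! ### Local search for set packings -/

namespace Packing

variable {α : Type*} [DecidableEq α] (P : ℕ → Finset α)

/-- Add `i` to the packing `X`, and remove everything that intersects it. -/
def ins (X : Finset ℕ) (i : ℕ) : Finset ℕ := insert i (X.filter fun j => Disjoint (P j) (P i))

/-- Add `g 0, …, g (k - 1)` one after the other. -/
def insAll (g : ℕ → ℕ) (X : Finset ℕ) : ℕ → Finset ℕ
  | 0 => X
  | k + 1 => ins P (insAll g X k) (g k)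

/-- Add `g 0, …, g (K - 1)` if this makes the packing larger. -/
def attempt (K : ℕ) (g : ℕ → ℕ) (X : Finset ℕ) : Finset ℕ :=
  if X.card < (insAll P g X K).card then insAll P g X K else X

/-- Make the attempt for all values below `m` of `g 0, …, g (d - 1)`. -/
def sweep (K m : ℕ) : ℕ → (ℕ → ℕ) → Finset ℕ → Finset ℕ
  | 0, g, X => attempt P K g X
  | d + 1, g, X => (List.range m).foldl (fun Y i => sweep K m d (Function.update g d i) Y) X

variable {P}

theorem pairwiseDisjoint_ins {X : Finset ℕ} (hX : (X : Set ℕ).PairwiseDisjoint P) (i : ℕ) :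
    (ins P X i : Set ℕ).PairwiseDisjoint P := by
  rw [ins, Finset.coe_insert]
  refine (hX.subset fun j hj => (Finset.mem_filter.1 hj).1).insert fun j hj _ => ?_
  exact (Finset.mem_filter.1 hj).2.symm

theorem pairwiseDisjoint_insAll {X : Finset ℕ} (hX : (X : Set ℕ).PairwiseDisjoint P) (g : ℕ → ℕ)
    (k : ℕ) : (insAll P g X k : Set ℕ).PairwiseDisjoint P := by
  induction k with
  | zero => exact hX
  | succ k ih => exact pairwiseDisjoint_ins ih _

theorem pairwiseDisjoint_attempt {X : Finset ℕ} (hX : (X : Set ℕ).PairwiseDisjoint P) (K : ℕ)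
    (g : ℕ → ℕ) : (attempt P K g X : Set ℕ).PairwiseDisjoint P := by
  rw [attempt]
  split_ifs
  · exact pairwiseDisjoint_insAll hX g K
  · exact hX

theorem pairwiseDisjoint_sweep (K m : ℕ) : ∀ (d : ℕ) (g : ℕ → ℕ) {X : Finset ℕ},
    (X : Set ℕ).PairwiseDisjoint P → (sweep P K m d g X : Set ℕ).PairwiseDisjoint P
  | 0, g, _, hX => pairwiseDisjoint_attempt hX K g
  | d + 1, g, X, hX => by
    rw [sweep]
    exact List.foldlRecOn (motive := fun Y : Finset ℕ => (Y : Set ℕ).PairwiseDisjoint P) _ _ hX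
      fun Y hY i _ => pairwiseDisjoint_sweep K m d _ hY

theorem ins_subset {m i : ℕ} {X : Finset ℕ} (hX : X ⊆ Finset.range m) (hi : i < m) :
    ins P X i ⊆ Finset.range m :=
  Finset.insert_subset (Finset.mem_range.2 hi) ((Finset.filter_subset _ _).trans hX)

theorem insAll_subset {m k : ℕ} {g : ℕ → ℕ} {X : Finset ℕ} (hX : X ⊆ Finset.range m)
    (hg : ∀ i < k, g i < m) : insAll P g X k ⊆ Finset.range m := by
  induction k with
  | zero => exact hX
  | succ k ih => exact ins_subset (ih fun i hi => hg i (by omega)) (hg k (by omega))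

theorem attempt_subset {m K : ℕ} {g : ℕ → ℕ} {X : Finset ℕ} (hX : X ⊆ Finset.range m)
    (hg : ∀ i < K, g i < m) : attempt P K g X ⊆ Finset.range m := by
  rw [attempt]
  split_ifs
  · exact insAll_subset hX hg
  · exact hX

theorem update_lt {m K d i : ℕ} {g : ℕ → ℕ} (hg : ∀ i < K, d + 1 ≤ i → g i < m) (hi : i < m) :
    ∀ j < K, d ≤ j → Function.update g d i j < m := by
  intro j hj hdj
  by_cases h : j = d
  · rw [h, Function.update_self]; exact hi
  · rw [Function.update_of_ne h]; exact hg j hj (by omega)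

theorem sweep_subset {m K : ℕ} : ∀ {d : ℕ} {g : ℕ → ℕ} {X : Finset ℕ}, X ⊆ Finset.range m →
    (∀ i < K, d ≤ i → g i < m) → sweep P K m d g X ⊆ Finset.range m
  | 0, _, _, hX, hg => attempt_subset hX fun i hi => hg i hi (Nat.zero_le _)
  | d + 1, g, X, hX, hg => by
    rw [sweep]
    exact List.foldlRecOn (motive := fun Y : Finset ℕ => Y ⊆ Finset.range m) _ _ hX
      fun Y hY i hi => sweep_subset hY (update_lt hg (List.mem_range.1 hi))

/-- `Y` is equal to `X` or larger. -/
def Climbs (X Y : Finset ℕ) : Prop := X = Y ∨ X.card < Y.card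

theorem Climbs.trans {X Y Z : Finset ℕ} (h : Climbs X Y) (h' : Climbs Y Z) : Climbs X Z := by
  rcases h with rfl | h
  · exact h'
  · rcases h' with rfl | h'
    · exact Or.inr h
    · exact Or.inr (h.trans h')

theorem Climbs.antisymm {X Y : Finset ℕ} (h : Climbs X Y) (h' : Climbs Y X) : X = Y := by
  rcases h with h | h
  · exact h
  · rcases h' with h' | h'
    · exact h'.symm
    · exact absurd h' (by omega)

theorem climbs_attempt (K : ℕ) (g : ℕ → ℕ) (X : Finset ℕ) : Climbs X (attempt P K g X) := by
  rw [attempt]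
  split_ifs with h
  · exact Or.inr h
  · exact Or.inl rfl

theorem climbs_foldl {f : Finset ℕ → ℕ → Finset ℕ} (hf : ∀ Y i, Climbs Y (f Y i)) (l : List ℕ)
    (X : Finset ℕ) : Climbs X (l.foldl f X) :=
  List.foldlRecOn (motive := fun Y : Finset ℕ => Climbs X Y) _ _ (Or.inl rfl)
    fun Y hY i _ => hY.trans (hf Y i)

/-- A change always gains cardinality and can never be undone, so a fold that ends where it began
has not moved at any step. -/
theorem eq_of_foldl_eq {f : Finset ℕ → ℕ → Finset ℕ} (hf : ∀ Y i, Climbs Y (f Y i))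
    {X : Finset ℕ} : ∀ {l : List ℕ}, l.foldl f X = X → ∀ i ∈ l, f X i = X
  | [], _, i, hi => absurd hi List.not_mem_nil
  | j :: l, h, i, hi => by
    rw [List.foldl_cons] at h
    have hj : f X j = X := ((hf X j).antisymm (by simpa only [h] using climbs_foldl hf l (f X j))).symm
    rw [hj] at h
    rcases List.mem_cons.1 hi with rfl | hi
    · exact hj
    · exact eq_of_foldl_eq hf h i hi

theorem climbs_sweep (K m : ℕ) : ∀ (d : ℕ) (g : ℕ → ℕ) (X : Finset ℕ), Climbs X (sweep P K m d g X)
  | 0, g, X => climbs_attempt K g X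
  | d + 1, g, X => climbs_foldl (fun Y i => climbs_sweep K m d (Function.update g d i) Y) _ X

/-- A packing that a sweep leaves unchanged cannot be improved by any attempt. -/
theorem attempt_eq_of_sweep_eq {K m : ℕ} : ∀ {d : ℕ} {g : ℕ → ℕ} {X : Finset ℕ},
    sweep P K m d g X = X → ∀ h : ℕ → ℕ, (∀ i < d, h i < m) → (∀ i, d ≤ i → h i = g i) →
      attempt P K h X = X
  | 0, g, X, hX, h, _, hg => by
    rwa [show h = g from funext fun i => hg i (Nat.zero_le i)]
  | d + 1, g, X, hX, h, hm, hg => by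
    refine attempt_eq_of_sweep_eq
      (eq_of_foldl_eq (fun Y i => climbs_sweep K m d (Function.update g d i) Y) hX (h d)
        (List.mem_range.2 (hm d (by omega)))) h (fun i hi => hm i (by omega)) fun i hi => ?_
    by_cases hid : i = d
    · rw [hid, Function.update_self]
    · rw [Function.update_of_ne hid, hg i (by omega)]

theorem insAll_congr {g h : ℕ → ℕ} {X : Finset ℕ} {k : ℕ} (hgh : ∀ i < k, g i = h i) :
    insAll P g X k = insAll P h X k := by
  induction k with
  | zero => rfl
  | succ k ih => rw [insAll, insAll, ih fun i hi => hgh i (by omega), hgh k (by omega)]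

theorem mem_insAll_of_mem {g : ℕ → ℕ} {X : Finset ℕ} {z : ℕ} (hz : z ∈ X) {k : ℕ}
    (h : ∀ i < k, z = g i ∨ Disjoint (P z) (P (g i))) : z ∈ insAll P g X k := by
  induction k with
  | zero => exact hz
  | succ k ih =>
    rw [insAll, ins, Finset.mem_insert, Finset.mem_filter]
    exact (h k (by omega)).imp_right fun hd => ⟨ih fun i hi => h i (by omega), hd⟩

theorem apply_mem_insAll {g : ℕ → ℕ} {X : Finset ℕ} {k j : ℕ} (hj : j < k)
    (h : ∀ i < k, g j = g i ∨ Disjoint (P (g j)) (P (g i))) : g j ∈ insAll P g X k := by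
  induction k with
  | zero => omega
  | succ k ih =>
    rw [insAll, ins, Finset.mem_insert, Finset.mem_filter]
    rcases (Nat.lt_succ_iff_lt_or_eq.1 hj) with hj | rfl
    · exact (h k (by omega)).imp_right fun hd => ⟨ih hj fun i hi => h i (by omega), hd⟩
    · exact Or.inl rfl

/-- Exchanges of fewer than `K` sets are covered by tuples of length exactly `K` because repetitions
are harmless. -/
theorem exists_enumeration {C : Finset ℕ} {K : ℕ} (hC : C.Nonempty) (hK : C.card ≤ K) :
    ∃ g : ℕ → ℕ, (∀ i, g i ∈ C) ∧ ∀ c ∈ C, ∃ i < K, g i = c := by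
  obtain ⟨c₀, hc₀⟩ := hC
  refine ⟨fun i => if h : i < C.card then C.equivFin.symm ⟨i, h⟩ else c₀, fun i => ?_,
    fun c hc => ⟨C.equivFin ⟨c, hc⟩, by omega, by simp⟩⟩
  dsimp only
  split_ifs
  · exact Subtype.coe_prop _
  · exact hc₀

/-- Exchanges of bounded size do not improve a local optimum. -/
theorem card_le_card_of_locally_optimal {m K : ℕ} {X B C : Finset ℕ} (hP : ∀ i, (P i).Nonempty)
    (hopt : ∀ h : ℕ → ℕ, (∀ i < K, h i < m) → attempt P K h X = X)
    (hB : (B : Set ℕ).PairwiseDisjoint P) (hBm : B ⊆ Finset.range m) (hC : C ⊆ B)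
    (hK : C.card ≤ K) :
    C.card ≤ (C.biUnion fun b => X.filter fun a => ¬ Disjoint (P a) (P b)).card := by
  rcases C.eq_empty_or_nonempty with rfl | hne
  · simp
  obtain ⟨g, hgC, hg⟩ := exists_enumeration hne hK
  set U := C.biUnion fun b => X.filter fun a => ¬ Disjoint (P a) (P b) with hU
  have h1 := hopt g fun i _ => Finset.mem_range.1 (hBm (hC (hgC i)))
  rw [attempt] at h1
  have h2 : (insAll P g X K).card ≤ X.card := by
    split_ifs at h1 with h
    · rw [h1]
    · exact not_lt.1 h
  have hUX : U ⊆ X := Finset.biUnion_subset.2 fun b _ => Finset.filter_subset _ _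
  -- The exchange keeps what `C` does not meet and adds all of `C`, whose members do not expel each
  -- other.
  have h3 : (X \ U) ∪ C ⊆ insAll P g X K := by
    refine Finset.union_subset (fun z hz => ?_) fun c hc => ?_
    · obtain ⟨hzX, hzU⟩ := Finset.mem_sdiff.1 hz
      refine mem_insAll_of_mem hzX fun i _ => Or.inr ?_
      by_contra hd
      exact hzU (Finset.mem_biUnion.2 ⟨g i, hgC i, Finset.mem_filter.2 ⟨hzX, hd⟩⟩)
    · obtain ⟨j, hj, rfl⟩ := hg c hc
      refine apply_mem_insAll hj fun i _ => ?_
      by_cases hij : g j = g i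
      · exact Or.inl hij
      · exact Or.inr (hB (hC (hgC j)) (hC (hgC i)) hij)
  have h4 : Disjoint (X \ U) C := by
    refine Finset.disjoint_left.2 fun z hz hzC => ?_
    obtain ⟨hzX, hzU⟩ := Finset.mem_sdiff.1 hz
    -- A common member of `X` and `C` meets itself, its set being nonempty, so it lies in `U`.
    refine hzU (Finset.mem_biUnion.2 ⟨z, hzC, Finset.mem_filter.2 ⟨hzX, ?_⟩⟩)
    rw [disjoint_self]
    exact (hP z).ne_empty
  have h5 := Finset.card_le_card h3
  rw [Finset.card_union_of_disjoint h4, Finset.card_sdiff_of_subset hUX] at h5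
  have h6 := Finset.card_le_card hUX
  omega

/-- A set intersects at most as many members of a packing as it has points. -/
theorem card_filter_not_disjoint_le {B : Finset ℕ} (hB : (B : Set ℕ).PairwiseDisjoint P)
    (S : Finset α) : (B.filter fun b => ¬ Disjoint (P b) S).card ≤ S.card := by
  rcases S.eq_empty_or_nonempty with rfl | ⟨x₀, _⟩
  · simp
  have key : ∀ b, ∃ x, b ∈ B.filter (fun b => ¬ Disjoint (P b) S) → x ∈ P b ∧ x ∈ S := by
    intro b
    by_cases hb : b ∈ B.filter fun b => ¬ Disjoint (P b) S
    · obtain ⟨x, hx⟩ := Finset.not_disjoint_iff.1 (Finset.mem_filter.1 hb).2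
      exact ⟨x, fun _ => hx⟩
    · exact ⟨x₀, fun h => absurd h hb⟩
  choose f hf using key
  refine Finset.card_le_card_of_injOn f (fun b hb => (hf b hb).2) fun b hb c hc hbc => ?_
  by_contra hne
  exact Finset.disjoint_left.1 (hB (Finset.mem_filter.1 hb).1 (Finset.mem_filter.1 hc).1 hne)
    (hf b hb).1 (hbc ▸ (hf c hc).1)

theorem two_mul_card_le_of_locally_optimal {m n : ℕ} {X B : Finset ℕ}
    (hP : ∀ i, (P i).Nonempty) (hP3 : ∀ i, (P i).card ≤ 3)
    (hX : (X : Set ℕ).PairwiseDisjoint P)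
    (hopt : ∀ h : ℕ → ℕ, (∀ i < 2 * 4 ^ (n + 1), h i < m) → attempt P (2 * 4 ^ (n + 1)) h X = X)
    (hB : (B : Set ℕ).PairwiseDisjoint P) (hBm : B ⊆ Finset.range m) :
    2 * n * B.card ≤ (3 * n + 1) * X.card := by
  refine card_le_of_locally_expanding (N := fun b => X.filter fun a => ¬ Disjoint (P a) (P b)) n
    (fun b _ => Finset.filter_subset _ _)
    (fun b _ => (card_filter_not_disjoint_le hX (P b)).trans (hP3 b)) (fun a ha => ?_)
    fun C hC hK => card_le_card_of_locally_optimal hP hopt hB hBm hC hK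
  refine le_trans (Finset.card_le_card fun b hb => ?_)
    ((card_filter_not_disjoint_le hB (P a)).trans (hP3 a))
  rw [Finset.mem_filter, Finset.mem_filter] at hb
  exact Finset.mem_filter.2 ⟨hb.1, fun hd => hb.2.2 hd.symm⟩

/-- The result of `k` sweeps, starting with the empty packing. -/
def search (P : ℕ → Finset α) (K m k : ℕ) : Finset ℕ := (sweep P K m K 0)^[k] ∅

theorem pairwiseDisjoint_search (K m k : ℕ) :
    (search P K m k : Set ℕ).PairwiseDisjoint P := by
  induction k with
  | zero => simp [search]
  | succ k ih =>
    rw [search, Function.iterate_succ_apply']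
    exact pairwiseDisjoint_sweep K m K 0 ih

theorem search_subset (K m k : ℕ) : search P K m k ⊆ Finset.range m := by
  induction k with
  | zero => simp [search]
  | succ k ih =>
    rw [search, Function.iterate_succ_apply']
    exact sweep_subset ih fun i hi hi' => absurd hi (by omega)

/-- Until it stabilizes, each sweep adds at least one member, and a packing has at most `m` members.
-/
theorem sweep_search (K m : ℕ) : sweep P K m K 0 (search P K m m) = search P K m m := by
  have key : ∀ k, sweep P K m K 0 (search P K m k) = search P K m k ∨
      k ≤ (search P K m k).card := by
    intro k
    induction k with
    | zero => exact Or.inr (Nat.zero_le _)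
    | succ k ih =>
      have hs : search P K m (k + 1) = sweep P K m K 0 (search P K m k) := by
        rw [search, Function.iterate_succ_apply', search]
      rcases climbs_sweep (P := P) K m K 0 (search P K m k) with h | h
      · left; rw [hs, ← h, ← h]
      · rcases ih with ih | ih
        · left; rw [hs, ih, ih]
        · right; rw [hs]; omega
  rcases key m with h | h
  · exact h
  · have h1 := search_subset (P := P) K m (m + 1)
    rw [search, Function.iterate_succ_apply', ← search] at h1
    have h2 := Finset.card_le_card h1
    rw [Finset.card_range] at h2
    rcases climbs_sweep (P := P) K m K 0 (search P K m m) with h3 | h3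
    · exact h3.symm
    · omega

theorem two_mul_card_le_search {m n : ℕ} {B : Finset ℕ}
    (hP : ∀ i, (P i).Nonempty) (hP3 : ∀ i, (P i).card ≤ 3)
    (hB : (B : Set ℕ).PairwiseDisjoint P) (hBm : B ⊆ Finset.range m) :
    2 * n * B.card ≤ (3 * n + 1) * (search P (2 * 4 ^ (n + 1)) m m).card := by
  refine two_mul_card_le_of_locally_optimal hP hP3 (pairwiseDisjoint_search _ _ _)
    (fun h hh => ?_) hB hBm
  set K := 2 * 4 ^ (n + 1)
  -- The sweeps start from the zero tuple, so the tuple is set to zero from `K` on; the attempt does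
  -- not see these entries.
  have h1 := attempt_eq_of_sweep_eq (sweep_search (P := P) K m) (fun i => if i < K then h i else 0)
    (fun i hi => by simpa only [if_pos hi] using hh i hi) fun i hi => if_neg (by omega)
  rwa [attempt, insAll_congr (h := h) fun i hi => if_pos hi, ← attempt] at h1

end Packing

/-! ### The local search as a machine program -/

namespace RAM

open Packing

/-- The two endvertices and the color of the edge whose entries are the cells `1 + 3 * i`,
`2 + 3 * i` and `3 + 3 * i` of `w`. -/
def pts (w : ℕ → ℕ) (i : ℕ) : Finset (ℕ ⊕ ℕ) :=
  {.inl (w (1 + 3 * i)), .inl (w (1 + 3 * i + 1)), .inr (w (1 + 3 * i + 2))}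

theorem pts_nonempty (w : ℕ → ℕ) (i : ℕ) : (pts w i).Nonempty := Finset.insert_nonempty _ _

theorem card_pts_le (w : ℕ → ℕ) (i : ℕ) : (pts w i).card ≤ 3 := Finset.card_le_three

/-- The value is `1` if `d` and `e` have the same value, and `0` otherwise. -/
def eqExp (d e : Exp) : Exp := .sub (.const 1) (.add (.sub d e) (.sub e d))

theorem eval_eqExp (d e : Exp) (s : State) :
    (eqExp d e).eval s = if d.eval s = e.eval s then 1 else 0 := by
  simp only [eqExp, Exp.eval]
  split_ifs <;> omega

/-- The value is nonzero if the edges at the addresses in the registers `x` and `y` have a common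
endvertex or the same color. -/
def meetExp (x y : ℕ) : Exp :=
  let entry (z d : ℕ) : Exp := .get 0 (.add (.reg z) (.const d))
  .add (eqExp (entry x 0) (entry y 0)) (.add (eqExp (entry x 0) (entry y 1))
    (.add (eqExp (entry x 1) (entry y 0)) (.add (eqExp (entry x 1) (entry y 1))
      (eqExp (entry x 2) (entry y 2)))))

theorem eval_meetExp_eq_zero {x y i j : ℕ} {s : State} (hx : s.reg x = 1 + 3 * i)
    (hy : s.reg y = 1 + 3 * j) :
    (meetExp x y).eval s = 0 ↔ Disjoint (pts (s.arr 0) i) (pts (s.arr 0) j) := by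
  simp only [meetExp, Exp.eval, eval_eqExp, hx, hy, pts, add_zero, Nat.add_eq_zero_iff,
    ite_eq_right_iff, one_ne_zero, imp_false, Finset.disjoint_left, Finset.mem_insert,
    Finset.mem_singleton, forall_eq_or_imp, forall_eq, Sum.inl.injEq, Sum.inr.injEq, reduceCtorEq,
    not_or, not_false_eq_true, and_true, true_and]
  tauto

/-- The array `a` is the characteristic function of the set `X` of numbers of edges. -/
def Stores (m a : ℕ) (X : Finset ℕ) (s : State) : Prop :=
  ∀ i < m, s.arr a (1 + 3 * i) = if i ∈ X then 1 else 0

/-- Copy array `b` into array `a`. -/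
def copyProg (a b : ℕ) : Prog := .forEach 1 (.store a (.reg 1) (.get b (.reg 1)))

def copyRun (a b : ℕ) : State → State := forRun 1 (storeAt a (.get b (.reg 1)))

theorem runsAs_copyProg (a b : ℕ) : RunsAs (copyProg a b) (copyRun a b) :=
  runsAs_forEach_store _ _

theorem stores_copyRun {m a b : ℕ} (hab : b ≠ a) {X : Finset ℕ} {s : State}
    (hm : s.reg 0 = 1 + 3 * m) (hX : Stores m b X s) : Stores m a X (copyRun a b s) := by
  refine forRun_storeAt hm _ fun i hi s' _ hs' _ hr => ?_
  rw [Exp.eval, Exp.eval, hr, hs' b hab, hX i hi]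

/-- Add the edge at the address in register `y` to the packing in array `3`. -/
def insExp (y : ℕ) : Exp :=
  .add (eqExp (.reg 1) (.reg y)) (.sub (.get 3 (.reg 1)) (meetExp 1 y))

def insProg (y : ℕ) : Prog := .forEach 1 (.store 3 (.reg 1) (insExp y))

def insRun (y : ℕ) : State → State := forRun 1 (storeAt 3 (insExp y))

theorem runsAs_insProg (y : ℕ) : RunsAs (insProg y) (insRun y) := runsAs_forEach_store _ _

theorem stores_insRun {m y k : ℕ} (hy : y ≠ 1) {X : Finset ℕ} {s : State}
    (hm : s.reg 0 = 1 + 3 * m) (hk : s.reg y = 1 + 3 * k) (hX : Stores m 3 X s) :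
    Stores m 3 (ins (pts (s.arr 0)) X k) (insRun y s) := by
  refine forRun_storeAt hm _ fun i hi s' hs hs' h3 hr => ?_
  have hyk : s'.reg y = 1 + 3 * k := by rw [hs y hy, hk]
  have h0 := eval_meetExp_eq_zero hr hyk
  rw [hs' 0 (by norm_num)] at h0
  simp only [insExp, Exp.eval, eval_eqExp, hr, hyk, h3, hX i hi]
  by_cases hik : i = k
  · subst hik
    -- The new edge meets itself, so its old indicator is cancelled and the equality test alone
    -- contributes 1.
    have h1 : (meetExp 1 y).eval s' ≠ 0 := by
      rw [Ne, h0, disjoint_self]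
      exact (pts_nonempty _ _).ne_empty
    rw [if_pos rfl, if_pos (show i ∈ ins (pts (s.arr 0)) X i from Finset.mem_insert_self _ _)]
    split_ifs <;> omega
  · rw [if_neg (by omega)]
    have h2 : i ∈ ins (pts (s.arr 0)) X k ↔ i ∈ X ∧ (meetExp 1 y).eval s' = 0 := by
      rw [ins, Finset.mem_insert, Finset.mem_filter, h0]
      tauto
    by_cases hz : (meetExp 1 y).eval s' = 0
    · simp only [h2, hz, and_true]
      omega
    · simp only [h2, hz, and_false, if_false]
      split_ifs <;> omega

/-- Count the members of the set that is stored in array `a`. -/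
def countProg (x a : ℕ) : Prog :=
  .seq (.assign x (.const 0))
    (.forEach 1 (.assign x (.add (.reg x) (.get a (.reg 1)))))

def countRun (x a : ℕ) (s : State) : State :=
  forRun 1 (fun s => s.setReg x (s.reg x + s.arr a (s.reg 1))) (s.setReg x 0)

theorem runsAs_countProg {x : ℕ} (hx : x ≠ 0) (hx1 : x ≠ 1) (a : ℕ) :
    RunsAs (countProg x a) (countRun x a) :=
  (runsAs_assign hx _).seq ((runsAs_assign hx _).forEach one_ne_zero fun _ => if_neg hx1.symm)

theorem countRun_reg {x y : ℕ} (hx : y ≠ x) (h1 : y ≠ 1) (a : ℕ) (s : State) :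
    (countRun x a s).reg y = s.reg y :=
  (forRun_reg h1 (fun _ => if_neg hx) _).trans (if_neg hx)

theorem countRun_arr (x a b : ℕ) (s : State) : (countRun x a s).arr b = s.arr b :=
  forRun_arr (F := fun s => s.setReg x (s.reg x + s.arr a (s.reg 1))) (fun _ => rfl) _

theorem countRun_self {m x a : ℕ} (hx : x ≠ 0) (hx1 : x ≠ 1) {X : Finset ℕ} {s : State}
    (hm : s.reg 0 = 1 + 3 * m) (hX : Stores m a X s) (hXm : X ⊆ Finset.range m) :
    (countRun x a s).reg x = X.card := by
  have h := forRun_induction (x := 1) (m := m)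
    (F := fun s => s.setReg x (s.reg x + s.arr a (s.reg 1))) (s := s.setReg x 0)
    (fun s => if_neg hx1.symm) ((if_neg hx.symm).trans hm)
    (fun i s' => s'.arr = s.arr ∧ s'.reg x = ∑ k ∈ Finset.range i, if k ∈ X then 1 else 0)
    ⟨rfl, by simp [State.setReg, hx1]⟩
    (fun i hi s' ⟨h1, h2⟩ hr => ⟨h1, by
      rw [Finset.sum_range_succ, ← h2, ← hX i hi]
      simp [State.setReg, hx1, hr, h1]⟩)
  refine h.2.trans ?_
  rw [← Finset.card_filter, Finset.filter_mem_eq_inter, Finset.inter_eq_right.2 hXm]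

/-- Array `3` becomes array `2` with the edges at the addresses in the registers `5, …, 4 + k`
added. -/
def insAllProg : ℕ → Prog
  | 0 => copyProg 3 2
  | k + 1 => .seq (insAllProg k) (insProg (5 + k))

def insAllRun : ℕ → State → State
  | 0 => copyRun 3 2
  | k + 1 => fun s => insRun (5 + k) (insAllRun k s)

theorem runsAs_insAllProg : ∀ k, RunsAs (insAllProg k) (insAllRun k)
  | 0 => runsAs_copyProg 3 2
  | k + 1 => (runsAs_insAllProg k).seq (runsAs_insProg (5 + k))

theorem insAllRun_reg {y : ℕ} (hy : y ≠ 1) : ∀ k s, (insAllRun k s).reg y = s.reg y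
  | 0, s => forRun_storeAt_reg _ _ hy s
  | k + 1, s => (forRun_storeAt_reg _ _ hy _).trans (insAllRun_reg hy k s)

theorem insAllRun_arr {a : ℕ} (ha : a ≠ 3) : ∀ k s, (insAllRun k s).arr a = s.arr a
  | 0, s => forRun_storeAt_arr _ ha s
  | k + 1, s => (forRun_storeAt_arr _ ha _).trans (insAllRun_arr ha k s)

theorem stores_insAllRun {m : ℕ} {g : ℕ → ℕ} {X : Finset ℕ} {s : State}
    (hm : s.reg 0 = 1 + 3 * m) (hX : Stores m 2 X s) {k : ℕ}
    (hg : ∀ i < k, s.reg (5 + i) = 1 + 3 * g i) :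
    Stores m 3 (insAll (pts (s.arr 0)) g X k) (insAllRun k s) := by
  induction k with
  | zero => exact stores_copyRun (by norm_num) hm hX
  | succ k ih =>
    have h := stores_insRun (y := 5 + k) (k := g k) (by omega)
      ((insAllRun_reg (by norm_num) k s).trans hm)
      ((insAllRun_reg (by omega) k s).trans (hg k (by omega)))
      (ih fun i hi => hg i (by omega))
    rwa [insAllRun_arr (by norm_num)] at h

/-- Replace the packing in array `2` by the one in array `3` if the latter is larger. -/
def improveProg : Prog :=
  -- Register `3` counts array `2` and register `2` counts array `3`, so the truncated difference is
  -- nonzero exactly when the tentative packing is larger.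
  .seq (countProg 3 2) (.seq (countProg 2 3)
    (.cond (.sub (.reg 2) (.reg 3)) (copyProg 2 3) .skip))

def improveRun (s : State) : State :=
  let s' := countRun 2 3 (countRun 3 2 s)
  if s'.reg 2 - s'.reg 3 ≠ 0 then copyRun 2 3 s' else s'

theorem runsAs_improveProg : RunsAs improveProg improveRun :=
  (runsAs_countProg (by norm_num) (by norm_num) 2).seq
    ((runsAs_countProg (by norm_num) (by norm_num) 3).seq
      ((runsAs_copyProg 2 3).cond (.sub (.reg 2) (.reg 3)) runsAs_skip))

theorem improveRun_reg {y : ℕ} (h1 : y ≠ 1) (h2 : y ≠ 2) (h3 : y ≠ 3) (s : State) :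
    (improveRun s).reg y = s.reg y := by
  have h : (countRun 2 3 (countRun 3 2 s)).reg y = s.reg y := by
    rw [countRun_reg h2 h1, countRun_reg h3 h1]
  rw [improveRun]
  split_ifs
  · exact (forRun_storeAt_reg _ _ h1 _).trans h
  · exact h

theorem improveRun_arr {a : ℕ} (ha : a ≠ 2) (s : State) : (improveRun s).arr a = s.arr a := by
  have h : (countRun 2 3 (countRun 3 2 s)).arr a = s.arr a := by
    rw [countRun_arr, countRun_arr]
  rw [improveRun]
  split_ifs
  · exact (forRun_storeAt_arr _ ha _).trans h
  · exact h

theorem stores_improveRun {m : ℕ} {X Y : Finset ℕ} {s : State}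
    (hm : s.reg 0 = 1 + 3 * m) (hX : Stores m 2 X s) (hXm : X ⊆ Finset.range m)
    (hY : Stores m 3 Y s) (hYm : Y ⊆ Finset.range m) :
    Stores m 2 (if X.card < Y.card then Y else X) (improveRun s) := by
  have hm' : (countRun 3 2 s).reg 0 = 1 + 3 * m := by
    rw [countRun_reg (by norm_num) (by norm_num), hm]
  have h2 : (countRun 2 3 (countRun 3 2 s)).reg 2 = Y.card := by
    refine countRun_self (m := m) (by norm_num) (by norm_num) hm' (fun i hi => ?_) hYm
    rw [countRun_arr]
    exact hY i hi
  have h3 : (countRun 2 3 (countRun 3 2 s)).reg 3 = X.card := by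
    rw [countRun_reg (by norm_num) (by norm_num)]
    exact countRun_self (by norm_num) (by norm_num) hm hX hXm
  rw [improveRun]
  simp only [h2, h3]
  by_cases h : X.card < Y.card
  · rw [if_pos h, if_pos (by omega)]
    refine stores_copyRun (by norm_num) ?_ fun i hi => ?_
    · rw [countRun_reg (by norm_num) (by norm_num), hm']
    · rw [countRun_arr, countRun_arr]
      exact hY i hi
  · rw [if_neg h, if_neg (by omega)]
    intro i hi
    rw [countRun_arr, countRun_arr]
    exact hX i hi

/-- Run through all values of the registers `5, …, 4 + d`, and try to improve the packing by adding
the edges at the addresses in the registers `5, …, 4 + K`. -/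
def sweepProg (K : ℕ) : ℕ → Prog
  | 0 => .seq (insAllProg K) improveProg
  | d + 1 => .forEach (5 + d) (sweepProg K d)

def sweepRun (K : ℕ) : ℕ → State → State
  | 0 => fun s => improveRun (insAllRun K s)
  | d + 1 => forRun (5 + d) (sweepRun K d)

theorem sweepRun_reg {K y : ℕ} (h1 : y ≠ 1) (h2 : y ≠ 2) (h3 : y ≠ 3) :
    ∀ {d : ℕ} (_ : y < 5 ∨ 5 + d ≤ y) (s : State), (sweepRun K d s).reg y = s.reg y
  | 0, _, s => (improveRun_reg h1 h2 h3 _).trans (insAllRun_reg h1 K s)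
  | _ + 1, h, s => forRun_reg (by omega) (sweepRun_reg h1 h2 h3 (by omega)) s

theorem sweepRun_arr {K a : ℕ} (h2 : a ≠ 2) (h3 : a ≠ 3) :
    ∀ (d : ℕ) (s : State), (sweepRun K d s).arr a = s.arr a
  | 0, s => (improveRun_arr h2 _).trans (insAllRun_arr h3 K s)
  | d + 1, s => forRun_arr (sweepRun_arr h2 h3 d) s

theorem runsAs_sweepProg (K : ℕ) : ∀ d, RunsAs (sweepProg K d) (sweepRun K d)
  | 0 => (runsAs_insAllProg K).seq runsAs_improveProg
  | d + 1 => (runsAs_sweepProg K d).forEach (by omega)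
      (sweepRun_reg (by omega) (by omega) (by omega) (by omega))

theorem stores_sweepRun {K m : ℕ} {w : ℕ → ℕ} : ∀ {d : ℕ} {g : ℕ → ℕ} {X : Finset ℕ} {s : State},
    s.reg 0 = 1 + 3 * m → s.arr 0 = w → Stores m 2 X s → X ⊆ Finset.range m →
    (∀ i < K, d ≤ i → s.reg (5 + i) = 1 + 3 * g i ∧ g i < m) →
    Stores m 2 (sweep (pts w) K m d g X) (sweepRun K d s)
  | 0, g, X, s, hm, hw, hX, hXm, hg => by
    refine stores_improveRun ((insAllRun_reg (by norm_num) K s).trans hm) (fun i hi => ?_) hXm ?_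
      (insAll_subset hXm fun i hi => (hg i hi (Nat.zero_le _)).2)
    · rw [insAllRun_arr (by norm_num)]
      exact hX i hi
    · rw [← hw]
      exact stores_insAllRun hm hX fun i hi => (hg i hi (Nat.zero_le _)).1
  | d + 1, g, X, s, hm, hw, hX, hXm, hg => by
    refine (forRun_induction (F := sweepRun K d)
      (sweepRun_reg (by omega) (by omega) (by omega) (by omega)) hm (fun i s' =>
      -- Only the length and the entries chosen by the outer loops must survive; the inner loops
      -- overwrite their own registers.
      (∀ y, y = 0 ∨ 5 + (d + 1) ≤ y → s'.reg y = s.reg y) ∧ s'.arr 0 = w ∧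
      (List.range i).foldl (fun Y i => sweep (pts w) K m d (Function.update g d i) Y) X ⊆
        Finset.range m ∧
      Stores m 2 ((List.range i).foldl
        (fun Y i => sweep (pts w) K m d (Function.update g d i) Y) X) s') ?_ ?_).2.2.2
    · exact ⟨fun y hy => if_neg (by omega), hw, hXm, hX⟩
    · rintro i hi s' ⟨h1, h2, h3, h4⟩ hr
      have hg' := update_lt (fun j hj hdj => (hg j hj hdj).2) hi
      rw [List.range_succ, List.foldl_append, List.foldl_cons, List.foldl_nil]
      refine ⟨fun y hy => ?_, ?_, sweep_subset h3 hg', ?_⟩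
      · rw [← h1 y hy, ← sweepRun_reg (K := K) (d := d) (y := y) (by omega) (by omega) (by omega)
          (by omega) s']
        exact if_neg (by omega)
      · exact (sweepRun_arr (by norm_num) (by norm_num) d s').trans h2
      · refine stores_sweepRun ((h1 0 (Or.inl rfl)).trans hm) h2 h4 h3
          fun j hj hdj => ⟨?_, hg' j hj hdj⟩
        by_cases hjd : j = d
        · rw [hjd, Function.update_self, hr]
        · rw [Function.update_of_ne hjd, h1 _ (Or.inr (by omega))]
          exact (hg j hj (by omega)).1

/-- The local search. -/
def searchProg (K : ℕ) : Prog := .forEach 4 (sweepProg K K)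

def searchRun (K : ℕ) : State → State := forRun 4 (sweepRun K K)

theorem runsAs_searchProg (K : ℕ) : RunsAs (searchProg K) (searchRun K) :=
  (runsAs_sweepProg K K).forEach (by norm_num)
    (sweepRun_reg (by norm_num) (by norm_num) (by norm_num) (by norm_num))

theorem searchRun_reg_zero (K : ℕ) (s : State) : (searchRun K s).reg 0 = s.reg 0 :=
  forRun_reg (by norm_num)
    (sweepRun_reg (by norm_num) (by norm_num) (by norm_num) (by norm_num)) s

theorem searchRun_arr_zero (K : ℕ) (s : State) : (searchRun K s).arr 0 = s.arr 0 :=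
  forRun_arr (sweepRun_arr (by norm_num) (by norm_num) K) s

theorem stores_searchRun (K : ℕ) {m : ℕ} {s : State} (hm : s.reg 0 = 1 + 3 * m)
    (h2 : ∀ i, s.arr 2 i = 0) :
    Stores m 2 (search (pts (s.arr 0)) K m m) (searchRun K s) := by
  refine (forRun_induction (F := sweepRun K K)
    (sweepRun_reg (by norm_num) (by norm_num) (by norm_num) (by norm_num)) hm (fun i s' =>
      s'.reg 0 = s.reg 0 ∧ s'.arr 0 = s.arr 0 ∧
      Stores m 2 (search (pts (s.arr 0)) K m i) s') ?_ ?_).2.2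
  · exact ⟨rfl, rfl, fun i _ => (h2 _).trans (by simp [search])⟩
  · rintro i _ s' ⟨h3, h4, h5⟩ _
    refine ⟨?_, (sweepRun_arr (by norm_num) (by norm_num) K s').trans h4, ?_⟩
    · rw [← h3, ← sweepRun_reg (K := K) (d := K) (y := 0) (by norm_num) (by norm_num)
        (by norm_num) (by norm_num) s']
      rfl
    · rw [search, Function.iterate_succ_apply', ← search]
      exact stores_sweepRun (h3.trans hm) h4 h5 (search_subset _ _ _)
        fun j hj hKj => absurd hj (by omega)

/-- Append the edge at the address in register `1` to the output if it belongs to the set stored in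
array `2`; register `2` holds the length of the output. -/
def emitProg : Prog :=
  .cond (.get 2 (.reg 1))
    (.seq (.store 1 (.reg 2) (.get 0 (.reg 1)))
      (.seq (.store 1 (.add (.reg 2) (.const 1)) (.get 0 (.add (.reg 1) (.const 1))))
        (.assign 2 (.add (.reg 2) (.const 2)))))
    .skip

def emitRun (s : State) : State :=
  if s.arr 2 (s.reg 1) ≠ 0 then
    ((s.setArr 1 (s.reg 2) (s.arr 0 (s.reg 1))).setArr 1 (s.reg 2 + 1)
      (s.arr 0 (s.reg 1 + 1))).setReg 2 (s.reg 2 + 2)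
  else s

theorem runsAs_emitProg : RunsAs emitProg emitRun :=
  ((runsAs_store 1 (.reg 2) (.get 0 (.reg 1))).seq
    ((runsAs_store 1 (.add (.reg 2) (.const 1)) (.get 0 (.add (.reg 1) (.const 1)))).seq
      (runsAs_assign two_ne_zero (.add (.reg 2) (.const 2))))).cond (.get 2 (.reg 1)) runsAs_skip

theorem emitRun_reg {y : ℕ} (hy : y ≠ 2) (s : State) : (emitRun s).reg y = s.reg y := by
  rw [emitRun]
  split_ifs
  · exact if_neg hy
  · rfl

theorem emitRun_arr {a : ℕ} (ha : a ≠ 1) (s : State) : (emitRun s).arr a = s.arr a := by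
  rw [emitRun]
  split_ifs
  · funext j
    simp [State.setReg, State.setArr, ha]
  · rfl

/-- Output the edges of the set stored in array `2`, up to the length of the output. -/
def outputProg : Prog := .seq (.assign 2 (.const 0)) (.forEach 1 emitProg)

def outputRun (s : State) : State := forRun 1 emitRun (s.setReg 2 0)

theorem runsAs_outputProg : RunsAs outputProg outputRun :=
  (runsAs_assign two_ne_zero _).seq
    (runsAs_emitProg.forEach one_ne_zero (emitRun_reg (by norm_num)))

/-- The endvertices of the edges with the numbers in `l`. -/
def pairs (w : ℕ → ℕ) (l : List ℕ) : List ℕ :=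
  l.flatMap fun i => [w (1 + 3 * i), w (1 + 3 * i + 1)]

theorem output_outputRun {m : ℕ} {X : Finset ℕ} {s : State} (hm : s.reg 0 = 1 + 3 * m)
    (hX : Stores m 2 X s) :
    (List.range ((outputRun s).reg 2)).map ((outputRun s).arr 1) =
      pairs (s.arr 0) ((List.range m).filter (· ∈ X)) := by
  refine (forRun_induction (F := emitRun) (emitRun_reg (by norm_num))
    (s := s.setReg 2 0) hm (fun i s' => s'.arr 0 = s.arr 0 ∧ s'.arr 2 = s.arr 2 ∧
      (List.range (s'.reg 2)).map (s'.arr 1) =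
        pairs (s.arr 0) ((List.range i).filter (· ∈ X))) ?_ ?_).2.2
  · exact ⟨rfl, rfl, rfl⟩
  · rintro i hi s' ⟨h0, h2, h1⟩ hr
    refine ⟨(emitRun_arr (by norm_num) s').trans h0, (emitRun_arr (by norm_num) s').trans h2, ?_⟩
    have hc : s'.arr 2 (s'.reg 1) = if i ∈ X then 1 else 0 := by rw [h2, hr, hX i hi]
    rw [List.range_succ, List.filter_append, pairs, List.flatMap_append, ← pairs, ← h1]
    by_cases hi : i ∈ X
    · rw [if_pos hi] at hc
      rw [emitRun, if_pos (by rw [hc]; exact one_ne_zero)]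
      simp [State.setReg, State.setArr, List.range_succ, hi, hr, h0]
      intro j hj
      rw [if_neg (by omega), if_neg (by omega)]
    · rw [if_neg hi] at hc
      simp [emitRun, hc, State.setReg, hi]

/-- The approximation algorithm. -/
def mainProg (K : ℕ) : Prog :=
  -- Register `0` bounds every loop, so it receives the output length only at the very end.
  .seq (.seq (searchProg K) outputProg) (.assign 0 (.reg 2))

/-- What the algorithm outputs, and in which time. -/
theorem exists_outputsWithin_mainProg (K : ℕ) : ∃ p : Polynomial ℕ, ∀ (m : ℕ) (w : List ℕ),
    w.length = 1 + 3 * m →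
      OutputsWithin (mainProg K) w (pairs (fun i => w.getD i 0)
        ((List.range m).filter (· ∈ search (pts fun i => w.getD i 0) K m m))) (p.eval w.length) := by
  obtain ⟨p, hp⟩ := (runsAs_searchProg K).seq runsAs_outputProg
  -- The 2 pays for the last assignment and `2 * X` for the output, two entries for each of at most
  -- `m` edges.
  refine ⟨p + 2 + 2 * .X, fun m w hw => ?_⟩
  obtain ⟨t, ht, h1, -⟩ := hp (State.init w)
  have h0 : (State.init w).reg 0 = w.length := rfl
  have ha : (State.init w).arr 0 = fun i => w.getD i 0 := by
    funext i
    simp [State.init]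
  have hs := stores_searchRun K (s := State.init w) (h0.trans hw) fun i => rfl
  rw [ha] at hs
  have ho := output_outputRun ((searchRun_reg_zero K _).trans (h0.trans hw)) hs
  rw [searchRun_arr_zero, ha] at ho
  refine ⟨_, _, .seq h1 (.assign 0 (.reg 2) _), ?_, ?_⟩
  · rw [← ho]
    simp [State.output, State.setReg, Exp.eval]
  · have hlen : ∀ (f : ℕ → ℕ) (l : List ℕ), (pairs f l).length = 2 * l.length := by
      intro f l
      simp [pairs, mul_comm]
    have hle := List.length_filter_le (· ∈ search (pts fun i => w.getD i 0) K m m) (List.range m)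
    rw [List.length_range] at hle
    have h2 : (2 : Polynomial ℕ).eval w.length = 2 := Polynomial.eval_natCast
    rw [hlen, Polynomial.eval_add, Polynomial.eval_add, Polynomial.eval_mul, h2,
      Polynomial.eval_X]
    rw [h0] at ht
    simp only [Exp.cost]
    omega

end RAM

/-! ### Encoded graphs and rainbow matchings as packings -/

open RAM Packing

theorem Finset.map_valEmbedding_filter_mem {m : ℕ} {X : Finset ℕ} (hX : X ⊆ Finset.range m) :
    (Finset.univ.filter fun i : Fin m => (i : ℕ) ∈ X).map Fin.valEmbedding = X := by
  ext k
  simp only [Finset.mem_map, Finset.mem_filter, Finset.mem_univ, true_and, Fin.valEmbedding_apply]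
  exact ⟨fun ⟨i, hi, hik⟩ => hik ▸ hi, fun hk => ⟨⟨k, Finset.mem_range.1 (hX hk)⟩, hk, rfl⟩⟩

namespace EdgeColoredGraph

theorem getD_flatMap_triples {β : Type*} (a b c : β → ℕ) : ∀ (L : List β) (i : ℕ)
    (h : i < L.length),
    (L.flatMap fun t => [a t, b t, c t]).getD (3 * i) 0 = a L[i] ∧
    (L.flatMap fun t => [a t, b t, c t]).getD (3 * i + 1) 0 = b L[i] ∧
    (L.flatMap fun t => [a t, b t, c t]).getD (3 * i + 2) 0 = c L[i]
  | [], i, h => absurd h (Nat.not_lt_zero i)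
  | t :: L, 0, _ => ⟨rfl, rfl, rfl⟩
  | t :: L, i + 1, h => getD_flatMap_triples a b c L i (by simpa using h)

/-- An enumeration of the edges, together with the word that represents it. -/
structure Enumeration (I : EdgeColoredGraph) (w : List ℕ) (m : ℕ) where
  fst : Fin m → Fin I.n
  snd : Fin m → Fin I.n
  edge : Fin m ↪ I.graph.edgeSet
  surj : Function.Surjective edge
  edge_eq : ∀ i, (edge i).1 = s(fst i, snd i)
  length : w.length = 1 + 3 * m
  getD_fst : ∀ i : Fin m, w.getD (1 + 3 * i) 0 = fst i
  getD_snd : ∀ i : Fin m, w.getD (1 + 3 * i + 1) 0 = snd i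
  getD_color : ∀ i : Fin m, w.getD (1 + 3 * i + 2) 0 = I.color (edge i)

theorem IsEncoding.exists_enumeration {I : EdgeColoredGraph} {w : List ℕ} (h : I.IsEncoding w) :
    ∃ m, Nonempty (I.Enumeration w m) := by
  obtain ⟨L, rfl, hn, hc, hs⟩ := h
  have hget := getD_flatMap_triples (fun t : Fin I.n × Fin I.n × ℕ => (t.1 : ℕ))
    (fun t => (t.2.1 : ℕ)) (fun t => t.2.2) L
  refine ⟨L.length, ⟨⟨fun i => L[i].1, fun i => L[i].2.1,
    ⟨fun i => ⟨s(L[i].1, L[i].2.1), (hc _ (L.getElem_mem i.2)).1⟩, fun i j hij => ?_⟩, ?_,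
    fun _ => rfl, ?_, fun i => ?_, fun i => ?_, fun i => ?_⟩⟩⟩
  · have hij' := congrArg Subtype.val hij
    refine Fin.ext ((List.Nodup.getElem_inj_iff hn (hi := by simp) (hj := by simp)).1 ?_)
    simpa using hij'
  · rintro ⟨e, he⟩
    obtain ⟨t, ht, rfl⟩ := List.mem_map.1 (hs e he)
    obtain ⟨i, hi, rfl⟩ := List.mem_iff_getElem.1 ht
    exact ⟨⟨i, hi⟩, rfl⟩
  · simp [List.length_flatMap, add_comm, mul_comm]
  · rw [add_comm, List.getD_cons_succ]
    exact (hget i i.2).1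
  · rw [add_assoc, add_comm, List.getD_cons_succ]
    exact (hget i i.2).2.1
  · rw [add_assoc, add_comm, List.getD_cons_succ]
    exact (hget i i.2).2.2.trans (hc _ (L.getElem_mem i.2)).2.symm

namespace Enumeration

variable {I : EdgeColoredGraph} {w : List ℕ} {m : ℕ}

/-- A common point is a common endvertex or a common color, as the two summands of the point type
cannot mix. For `i = j` both sides fail. -/
theorem disjoint_pts_iff (E : I.Enumeration w m) (i j : Fin m) :
    Disjoint (pts (fun k => w.getD k 0) i) (pts (fun k => w.getD k 0) j) ↔
      (∀ v, ¬ (v ∈ (E.edge i).1 ∧ v ∈ (E.edge j).1)) ∧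
        I.color (E.edge i) ≠ I.color (E.edge j) := by
  simp only [pts, E.getD_fst, E.getD_snd, E.getD_color, E.edge_eq, Sym2.mem_iff,
    Finset.disjoint_left, Finset.mem_insert, Finset.mem_singleton, forall_eq_or_imp, forall_eq,
    Sum.inl.injEq, Sum.inr.injEq, reduceCtorEq, not_or, not_false_eq_true, and_true, true_and,
    not_and, Fin.val_inj, and_assoc, ne_eq]

theorem isRainbowMatching_iff (E : I.Enumeration w m) (S : Finset (Fin m)) :
    I.IsRainbowMatching (S.map E.edge) ↔
      (S.map Fin.valEmbedding : Set ℕ).PairwiseDisjoint (pts fun k => w.getD k 0) := by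
  constructor
  · rintro ⟨h1, h2⟩ _ hi _ hj hij
    obtain ⟨i, hiS, rfl⟩ := Finset.mem_map.1 hi
    obtain ⟨j, hjS, rfl⟩ := Finset.mem_map.1 hj
    have hne : E.edge i ≠ E.edge j := fun h => hij (congrArg _ (E.edge.injective h))
    have hi' := Finset.mem_map_of_mem E.edge hiS
    have hj' := Finset.mem_map_of_mem E.edge hjS
    exact (E.disjoint_pts_iff i j).2 ⟨h1 _ hi' _ hj' hne, fun h => hne (h2 hi' hj' h)⟩
  · intro h
    have key : ∀ i ∈ S, ∀ j ∈ S, i ≠ j → _ := fun i hi j hj hij =>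
      (E.disjoint_pts_iff i j).1 (h (Finset.mem_map_of_mem Fin.valEmbedding hi)
        (Finset.mem_map_of_mem Fin.valEmbedding hj) fun hh => hij (Fin.ext hh))
    refine ⟨fun e he f hf hef => ?_, fun e he f hf hef => ?_⟩
    · obtain ⟨i, hi, rfl⟩ := Finset.mem_map.1 he
      obtain ⟨j, hj, rfl⟩ := Finset.mem_map.1 hf
      exact (key i hi j hj fun hij => hef (congrArg _ hij)).1
    · obtain ⟨i, hi, rfl⟩ := Finset.mem_map.1 he
      obtain ⟨j, hj, rfl⟩ := Finset.mem_map.1 hf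
      by_contra hne
      exact (key i hi j hj fun hij => hne (congrArg _ hij)).2 hef

theorem isEdgeList_pairs (E : I.Enumeration w m) (X : Finset ℕ) :
    I.IsEdgeList ((Finset.univ.filter fun i : Fin m => (i : ℕ) ∈ X).map E.edge)
      (pairs (fun k => w.getD k 0) ((List.range m).filter (· ∈ X))) := by
  have hinj : Function.Injective fun i => s(E.fst i, E.snd i) := by
    intro i j hij
    simp only [← E.edge_eq] at hij
    exact E.edge.injective (Subtype.ext hij)
  refine ⟨((List.finRange m).filter fun i : Fin m => (i : ℕ) ∈ X).map
    fun i => (E.fst i, E.snd i), ?_, ?_, fun e => ?_⟩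
  · rw [← List.map_coe_finRange_eq_range, List.filter_map, pairs, List.flatMap_map,
      List.flatMap_map]
    simp only [E.getD_fst, E.getD_snd]
    rfl
  · rw [List.map_map]
    exact ((List.nodup_finRange m).filter _).map hinj
  · simp only [List.map_map, List.mem_map, List.mem_filter, List.mem_finRange, true_and,
      decide_eq_true_eq, Function.comp_apply, Finset.mem_map, Finset.mem_filter, Finset.mem_univ]
    constructor
    · rintro ⟨i, hi, rfl⟩
      exact ⟨_, ⟨i, hi, rfl⟩, E.edge_eq i⟩
    · rintro ⟨_, ⟨i, hi, rfl⟩, rfl⟩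
      exact ⟨i, hi, (E.edge_eq i).symm⟩

theorem exists_packing_card_eq_opt (E : I.Enumeration w m) :
    ∃ B ⊆ Finset.range m,
    (B : Set ℕ).PairwiseDisjoint (pts fun k => w.getD k 0) ∧ B.card = I.opt := by
  classical
  obtain ⟨M, hM, hc⟩ := I.isGreatest_opt.1
  have hmap : (Finset.univ.filter fun i => E.edge i ∈ M).map E.edge = M := by
    ext e
    obtain ⟨i, rfl⟩ := E.surj e
    simp
  refine ⟨(Finset.univ.filter fun i => E.edge i ∈ M).map Fin.valEmbedding, ?_,
    (E.isRainbowMatching_iff _).1 (hmap.symm ▸ hM), ?_⟩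
  · intro k hk
    obtain ⟨i, -, rfl⟩ := Finset.mem_map.1 hk
    exact Finset.mem_range.2 i.2
  · rw [Finset.card_map, ← hc, ← Finset.card_map E.edge, hmap]

end Enumeration

end EdgeColoredGraph

/-! ### The approximation ratio -/

theorem polynomial_eval_le_eval (p : Polynomial ℕ) {a b : ℕ} (h : a ≤ b) :
    p.eval a ≤ p.eval b := by
  rw [Polynomial.eval_eq_sum, Polynomial.eval_eq_sum]
  exact Finset.sum_le_sum fun i _ => Nat.mul_le_mul_left _ (Nat.pow_le_pow_left h i)

theorem RAM.length_le_inputSize (w : List ℕ) : w.length ≤ inputSize w := by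
  induction w with
  | nil => simp
  | cons x w ih =>
    simp only [inputSize, List.length_cons, List.map_cons, List.sum_cons] at ih ⊢
    omega

theorem isPolyTimeApprox_mainProg (n : ℕ) :
    IsPolyTimeApproxForMaxRainbowMatching (mainProg (2 * 4 ^ (n + 1)))
      (2 * n / (3 * n + 1)) := by
  obtain ⟨p, hp⟩ := exists_outputsWithin_mainProg (2 * 4 ^ (n + 1))
  refine ⟨p, fun I w hw => ?_⟩
  obtain ⟨m, ⟨E⟩⟩ := hw.exists_enumeration
  set X := search (pts fun i => w.getD i 0) (2 * 4 ^ (n + 1)) m m with hX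
  have hXm : X ⊆ Finset.range m := search_subset _ _ _
  have hmap := Finset.map_valEmbedding_filter_mem hXm
  obtain ⟨s, t, h1, h2, h3⟩ := hp m w E.length
  refine ⟨(Finset.univ.filter fun i : Fin m => (i : ℕ) ∈ X).map E.edge, _,
    ⟨s, t, h1, h2, h3.trans (polynomial_eval_le_eval p (length_le_inputSize w))⟩,
    E.isEdgeList_pairs X, (E.isRainbowMatching_iff _).2 ?_, ?_⟩
  · rw [hmap]
    exact pairwiseDisjoint_search _ _ _
  · obtain ⟨B, hBm, hB, hc⟩ := E.exists_packing_card_eq_opt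
    have h := two_mul_card_le_search (n := n) (pts_nonempty _) (card_pts_le _) hB hBm
    rw [Finset.card_map, ← Finset.card_map Fin.valEmbedding, hmap, ← hc, div_mul_eq_mul_div,
      div_le_iff₀ (by positivity), mul_comm (X.card : ℝ)]
    exact_mod_cast h

theorem IsPolyTimeApproxForMaxRainbowMatching.mono {P : RAM.Prog} {α β : ℝ}
    (h : IsPolyTimeApproxForMaxRainbowMatching P α) (hβ : β ≤ α) :
    IsPolyTimeApproxForMaxRainbowMatching P β := by
  obtain ⟨p, hp⟩ := h
  refine ⟨p, fun I w hw => ?_⟩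
  obtain ⟨M, z, h1, h2, h3, h4⟩ := hp I w hw
  exact ⟨M, z, h1, h2, h3, (mul_le_mul_of_nonneg_right hβ (Nat.cast_nonneg _)).trans h4⟩

theorem theorem3p1 (ε : ℝ) (hε : 0 < ε) :
    ∃ P : RAM.Prog, IsPolyTimeApproxForMaxRainbowMatching P (2 / 3 - ε) := by
  -- The ratio `2n/(3n+1)` falls short of `2/3` by `2/(9n+3)`, which is less than `1/n < ε`.
  obtain ⟨n, hn⟩ := exists_nat_gt (1 / ε)
  refine ⟨_, (isPolyTimeApprox_mainProg n).mono ?_⟩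
  rw [div_lt_iff₀ hε] at hn
  rw [le_div_iff₀ (by positivity)]
  nlinarith
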